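/- **Setting.** Let $T$ be a finite horizon and $\mathcal N$ a finite set of units. For each unit $\nu$ let $\mathbb X^\nu_t$ ($0\le t\le T$), $\mathbb U^\nu_t$ ($0\le t\le T-1$) and $\mathbb W^\nu_t$ ($1\le t\le T$) be measurable spaces (states, controls, noises), the state and control spaces being nonempty and the control spaces standard Borel. Let $\mathcal R^\nu_t$ (a measurable space) and $\mathcal P^\nu_t$ ($0\le t\le T-1$) be real vector spaces paired by a bilinear form $\langle\cdot,\cdot\rangle$ that is measurable in its second argument. Let $g^\nu_t:\mathbb X^\nu_t\times\mathbb U^\nu_t\times\mathbb W^\nu_{t+1}\to\mathbb X^\nu_{t+1}$, $\Theta^\nu_t:\mathbb X^\nu_t\times\mathbb U^\nu_t\to\mathcal R^\nu_t$, $L^\nu_t:\mathbb X^\nu_t\times\mathbb U^\nu_t\times\mathbb W^\nu_{t+1}\to(-\infty,+\infty]$ and $K^\nu:\mathbb X^\nu_T\to(-\infty,+\infty]$ be measurable. On a probability space $(\Omega,\mathcal F,\mathbb P)$ let $W^\nu_t:\Omega\to\mathbb W^\nu_t$ be random variables, and $W_t=(W^\nu_t)_{\nu\in\mathcal N}$.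 The centralized information structure is $\mathcal G^\nu_t=\sigma(W_1,\dots,W_t)$, the decentralized one is $\mathcal G^\nu_t=\sigma(W^\nu_1,\dots,W^\nu_t)$; both are trivial at $t=0$. Given a price process $p^\nu=(p^\nu_0,\dots,p^\nu_{T-1})$, the local price value function at time $t\in\{0,\dots,T\}$ is $$\underline V^\nu_t[p^\nu](x)=\inf_{X,U}\ \mathbb E\Big[\sum_{s=t}^{T-1}\big(L^\nu_s(X_s,U_s,W^\nu_{s+1})+\langle p^\nu_s,\Theta^\nu_s(X_s,U_s)\rangle\big)+K^\nu(X_T)\Big],\qquad x\in\mathbb X^\nu_t,$$ the infimum being over all processes with $X_t=x$ and, for $s=t,\dots,T-1$, $X_{s+1}=g^\nu_s(X_s,U_s,W^\nu_{s+1})$ and $U_s$ measurable with respect to $\mathcal G^\nu_s$. **Conventions.** $(+\infty)+(-\infty)=+\infty$, and $\mathbb E[f]=\mathbb E[f^+]-\mathbb E[f^-]$ for $f$ with values in $[-\infty,+\infty]$, read as $+\infty$ whenever $\mathbb E[f^+]=+\infty$. **Proposition.** Assume that $W_1,\dots,W_T$ are independent. Let $\nu\in\mathcal N$, let $p^\nu=(p^\nu_0,\dots,p^\nu_{T-1})$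 be deterministic, and take either the centralized or the decentralized information structure. Assume that, for all $t\in\{0,\dots,T\}$, all $x\in\mathbb X^\nu_t$ and all $(X,U)$ admissible in the definition of $\underline V^\nu_t[p^\nu](x)$, the expected value in that definition is well defined (the positive and the negative part of the total cost do not both have infinite expectation). Then $\underline V^\nu_T[p^\nu]=K^\nu$ and, for $t=T-1,\dots,0$ and all $x\in\mathbb X^\nu_t$, $$\underline V^\nu_t[p^\nu](x)=\inf_{u\in\mathbb U^\nu_t}\mathbb E\Big[L^\nu_t(x,u,W^\nu_{t+1})+\langle p^\nu_t,\Theta^\nu_t(x,u)\rangle+\underline V^\nu_{t+1}[p^\nu]\big(g^\nu_t(x,u,W^\nu_{t+1})\big)\Big],$$ where, for every $u\in\mathbb U^\nu_t$, the integrand on the right is measurable up to a $\mathbb P$-null set. -/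

import Mathlib

open MeasureTheory ProbabilityTheory

namespace MultistageDecomposition

/-- Addition of extended reals for minimization problems: `+∞` is absorbing, in particular
`(+∞) + (-∞) = +∞`. In all other cases it is the usual addition. -/
noncomputable def upperAdd (a b : EReal) : EReal :=
  open Classical in if a = ⊤ ∨ b = ⊤ then ⊤ else a + b

/-- Expectation of an extended real valued function, `E[f⁺] - E[f⁻]`, with the convention for
minimization problems that it is `+∞` as soon as `E[f⁺] = +∞`. -/
noncomputable def expect {Ω : Type*} [MeasurableSpace Ω] (μ : Measure Ω) (f : Ω → EReal) : EReal :=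
  open Classical in
  if ∫⁻ ω, (f ω).toENNReal ∂μ = ⊤ then ⊤
  else ((∫⁻ ω, (f ω).toENNReal ∂μ : ENNReal) : EReal)
    - ((∫⁻ ω, (-f ω).toENNReal ∂μ : ENNReal) : EReal)

/-- The expectation of `f` is well defined: `f` is (a.e.) measurable, and `E[f⁺]` and `E[f⁻]` are
not both infinite. -/
def HasExpectation {Ω : Type*} [MeasurableSpace Ω] (μ : Measure Ω) (f : Ω → EReal) : Prop :=
  AEMeasurable f μ ∧ (∫⁻ ω, (f ω).toENNReal ∂μ ≠ ⊤ ∨ ∫⁻ ω, (-f ω).toENNReal ∂μ ≠ ⊤)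

/-- Local data of all the units `n : N` over the time span `0, …, T`: `X t n`, `U t n`, `E t n`,
`R t n`, `P t n` are the local state, control, noise, resource and price spaces of unit `n` at
time `t`. Families are indexed by all of `ℕ`, but only the times up to the horizon `T` matter
(states for `t ≤ T`, noises for `1 ≤ t ≤ T`, everything else for `t < T`). -/
structure LocalData (T : ℕ) (N : Type*) (X U E R P : ℕ → N → Type*)
    [∀ t n, MeasurableSpace (X t n)] [∀ t n, MeasurableSpace (U t n)]
    [∀ t n, MeasurableSpace (E t n)] [∀ t n, MeasurableSpace (R t n)]
    [∀ t n, AddCommGroup (R t n)] [∀ t n, Module ℝ (R t n)]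
    [∀ t n, AddCommGroup (P t n)] [∀ t n, Module ℝ (P t n)] where
  /-- local dynamics `g` -/
  dyn : ∀ t n, X t n → U t n → E (t + 1) n → X (t + 1) n
  measurable_dyn : ∀ t n,
    Measurable fun z : X t n × U t n × E (t + 1) n => dyn t n z.1 z.2.1 z.2.2
  /-- local coupling functions `Θ` -/
  coupling : ∀ t n, X t n → U t n → R t n
  measurable_coupling : ∀ t n, Measurable fun z : X t n × U t n => coupling t n z.1 z.2
  /-- local instantaneous costs `L`, with values in `(-∞, +∞]` -/
  cost : ∀ t n, X t n → U t n → E (t + 1) n → EReal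
  measurable_cost : ∀ t n,
    Measurable fun z : X t n × U t n × E (t + 1) n => cost t n z.1 z.2.1 z.2.2
  cost_ne_bot : ∀ t n x u w, cost t n x u w ≠ ⊥
  /-- local final costs `K`, with values in `(-∞, +∞]` -/
  finalCost : ∀ n, X T n → EReal
  measurable_finalCost : ∀ n, Measurable (finalCost n)
  finalCost_ne_bot : ∀ n x, finalCost n x ≠ ⊥
  /-- duality pairing of prices and resources, a bilinear form -/
  pairing : ∀ t n, P t n →ₗ[ℝ] R t n →ₗ[ℝ] ℝ
  measurable_pairing : ∀ t n (p : P t n), Measurable fun r : R t n => pairing t n p r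

/-- The two information structures. -/
inductive InfoStructure : Type
  | centralized
  | decentralized

/-- The `σ`-field `𝒢` of the information available to unit `n` at time `t`: generated by the
noises of all the units at times `1, …, t` (centralized), or by the noises of unit `n` alone at
times `1, …, t` (decentralized). It is trivial at `t = 0`. -/
@[reducible] def InfoStructure.field {Ω N : Type*} {E : ℕ → N → Type*} [∀ t n, MeasurableSpace (E t n)]
    (info : InfoStructure) (W : ∀ t n, Ω → E t n) (t : ℕ) (n : N) : MeasurableSpace Ω :=
  match info with
  | .centralized =>
      ⨆ s ∈ Set.Icc 1 t, MeasurableSpace.comap (fun ω (m : N) => W s m ω) MeasurableSpace.pi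
  | .decentralized =>
      ⨆ s ∈ Set.Icc 1 t, MeasurableSpace.comap (W s n) inferInstance

section

variable {T : ℕ} {N : Type*} {X U E R P : ℕ → N → Type*}
    [∀ t n, MeasurableSpace (X t n)] [∀ t n, MeasurableSpace (U t n)]
    [∀ t n, MeasurableSpace (E t n)] [∀ t n, MeasurableSpace (R t n)]
    [∀ t n, AddCommGroup (R t n)] [∀ t n, Module ℝ (R t n)]
    [∀ t n, AddCommGroup (P t n)] [∀ t n, Module ℝ (P t n)]
    {Ω : Type*}

/-- The constraints of the local price problem of unit `n` that starts from the state `x` at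
time `t`, on a local state process `x'` and a local control process `u`: initial condition,
dynamics, and measurability of the controls with respect to the available information. The
components of the processes before `t` (and, for controls, from `T` on) are irrelevant. -/
structure LocalData.IsAdmissible (D : LocalData T N X U E R P) (W : ∀ t n, Ω → E t n)
    (info : InfoStructure) (n : N) (t : ℕ) (x : X t n)
    (x' : ∀ s, Ω → X s n) (u : ∀ s, Ω → U s n) : Prop where
  init : ∀ ω, x' t ω = x
  dynamics : ∀ s, t ≤ s → s < T → ∀ ω, x' (s + 1) ω = D.dyn s n (x' s ω) (u s ω) (W (s + 1) n ω)
  nonanticipative : ∀ s, t ≤ s → s < T → Measurable[info.field W s n] (u s)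

/-- Instantaneous cost plus price of the resource use, `L(x, u, w) + ⟨p, Θ(x, u)⟩`. -/
noncomputable def LocalData.pricedCost (D : LocalData T N X U E R P) (n : N) (t : ℕ) (p : P t n)
    (x : X t n) (u : U t n) (w : E (t + 1) n) : EReal :=
  D.cost t n x u w + ((D.pairing t n p (D.coupling t n x u) : ℝ) : EReal)

/-- The random total cost from time `t` on of unit `n` under the (stochastic) price process `p`. -/
noncomputable def LocalData.totalCost (D : LocalData T N X U E R P) (W : ∀ t n, Ω → E t n)
    (n : N) (p : ∀ s, Ω → P s n) (t : ℕ) (x' : ∀ s, Ω → X s n) (u : ∀ s, Ω → U s n)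
    (ω : Ω) : EReal :=
  (∑ s ∈ Finset.Ico t T, D.pricedCost n s (p s ω) (x' s ω) (u s ω) (W (s + 1) n ω))
    + D.finalCost n (x' T ω)

/-- The local price value function of unit `n` at time `t` for the (stochastic) price process `p`:
infimum of the expected total cost over all admissible state and control processes. -/
noncomputable def LocalData.priceValue [MeasurableSpace Ω] (D : LocalData T N X U E R P)
    (μ : Measure Ω) (W : ∀ t n, Ω → E t n) (info : InfoStructure) (n : N)
    (p : ∀ s, Ω → P s n) (t : ℕ) (x : X t n) : EReal :=
  ⨅ (x' : ∀ s, Ω → X s n) (u : ∀ s, Ω → U s n) (_ : D.IsAdmissible W info n t x x' u),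
    expect μ (D.totalCost W n p t x' u)

end

end MultistageDecomposition

/-!
The Bellman equation is the usual one-step decomposition of the expected cost; the work lies in the
measurability of the value function and in the choice of almost optimal continuations, because the
state and noise spaces are arbitrary measurable spaces and the value function need not be
measurable.

**Noise paths.** Both information structures amount to a unit that observes independent noises `η t`
between the times `t` and `t + 1`. By the Doob-Dynkin lemma, for which the control spaces have
to be standard Borel, an admissible control is a function of the noise path, and the problem becomes a
`ControlModel` under the law `Q` of that path (`LocalData.priceValue_eq_value`). Independence is used
in the form `IsSpliceInvariant`: replacing the path from time `k` on by an independent copy does not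
change `Q`. With Fubini's theorem for the extended expectation (`expect_prod`), which applies because
the expected costs are well defined, this yields conditioning on the past
(`IsSpliceInvariant.expect_eq`).

**Lower bound.** Freezing the noises before time `t` makes the control at time `t` constant; freezing
those up to time `t + 1` leaves an admissible continuation from the next state, whose cost is at
least the value there (`ControlModel.iInf_expect_bellmanCost_le`).

**Upper bound.** By backward induction, the value function is the infimum of the costs of a *jointly
measurable* family of policies indexed by `ℕ → ℕ` (`ControlModel.IsSufficientFamily`). So the cost
`H (y, z)` of a stage followed by the policy with index `z` is measurable, and one needs an almost
optimal `z` as a function of `y`. The theorem `exists_selector_iInf` gives a single jointly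
measurable function `S (y, θ)` such that, for each finite measure, some `θ` is almost optimal almost
everywhere; it also gives the a.e. measurability of `⨅ z, H (y, z)`. Since `θ` and `u`
range over standard Borel spaces, the policies "play `u`, then continue with `S (·, θ)`" form a sufficient family
one step earlier, and the induction goes on (`ControlModel.bellman_step`).

**Selection.** The set `{y | ∃ z, H (y, z) < q}` is the set of the points that have an infinite branch
in a Souslin scheme. The points that have a branch below a fixed `σ : ℕ → ℕ` form a set that is
measurable, jointly in the point and in `σ`, by compactness of `{τ | τ ≤ σ}`; on it the leftmost
branch is a measurable choice. By continuity of outer measures along increasing sequences,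
countably many of these sets exhaust the whole set up to a null set
(`IsSouslinScheme.exists_le_measure`).
-/

namespace MultistageDecomposition

open Filter Topology

/-! ### Addition and expectation of extended real valued costs -/

section Expectation

variable {A B : Type*} [MeasurableSpace A] [MeasurableSpace B] {μ : Measure A} {ν : Measure B}

@[simp] theorem upperAdd_top_left (b : EReal) : upperAdd ⊤ b = ⊤ := by simp [upperAdd]

theorem upperAdd_coe (r : ℝ) (b : EReal) : upperAdd r b = r + b := by
  unfold upperAdd
  split_ifs with h
  · rcases h with h | rfl
    · simp at h
    · simp
  · rfl

theorem upperAdd_mono_right (a : EReal) {b b' : EReal} (h : b ≤ b') :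
    upperAdd a b ≤ upperAdd a b' := by
  unfold upperAdd
  split_ifs with h1 h2 h2
  · exact le_rfl
  · rcases h1 with h1 | rfl
    · exact absurd (Or.inl h1) h2
    · exact absurd (Or.inr (top_le_iff.mp h)) h2
  · exact le_top
  · gcongr

theorem measurable_upperAdd : Measurable fun z : EReal × EReal => upperAdd z.1 z.2 := by
  unfold upperAdd
  refine Measurable.ite ?_ measurable_const (measurable_fst.add measurable_snd)
  exact (measurable_fst (measurableSet_singleton ⊤)).union
    (measurable_snd (measurableSet_singleton ⊤))

theorem upperAdd_iInf {ι : Sort*} [Nonempty ι] {a : EReal} (ha : a ≠ ⊥) (f : ι → EReal) :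
    upperAdd a (⨅ i, f i) = ⨅ i, upperAdd a (f i) := by
  induction a with
  | bot => exact absurd rfl ha
  | top => simp
  | coe r =>
    simp only [upperAdd_coe]
    refine le_antisymm (le_iInf fun i => by gcongr; exact iInf_le _ i) ?_
    rw [add_comm, ← EReal.sub_le_iff_le_add (by simp) (by simp)]
    refine le_iInf fun i => ?_
    rw [EReal.sub_le_iff_le_add (by simp) (by simp), add_comm]
    exact iInf_le (fun i => (r : EReal) + f i) i

theorem expect_of_eq_top {f : A → EReal} (h : ∫⁻ a, (f a).toENNReal ∂μ = ⊤) :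
    expect μ f = ⊤ := if_pos h

theorem expect_of_ne_top {f : A → EReal} (h : ∫⁻ a, (f a).toENNReal ∂μ ≠ ⊤) :
    expect μ f = ((∫⁻ a, (f a).toENNReal ∂μ : ENNReal) : EReal)
      - ((∫⁻ a, (-f a).toENNReal ∂μ : ENNReal) : EReal) := if_neg h

theorem expect_mono {f g : A → EReal} (h : f ≤ᵐ[μ] g) : expect μ f ≤ expect μ g := by
  have h1 : ∫⁻ a, (f a).toENNReal ∂μ ≤ ∫⁻ a, (g a).toENNReal ∂μ :=
    lintegral_mono_ae (h.mono fun a ha => EReal.toENNReal_le_toENNReal ha)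
  have h2 : ∫⁻ a, (-g a).toENNReal ∂μ ≤ ∫⁻ a, (-f a).toENNReal ∂μ :=
    lintegral_mono_ae (h.mono fun a ha =>
      EReal.toENNReal_le_toENNReal (EReal.neg_le_neg_iff.mpr ha))
  by_cases hg : ∫⁻ a, (g a).toENNReal ∂μ = ⊤
  · rw [expect_of_eq_top hg]; exact le_top
  · rw [expect_of_ne_top hg, expect_of_ne_top (ne_top_of_le_ne_top hg h1)]
    exact EReal.sub_le_sub (by exact_mod_cast h1) (by exact_mod_cast h2)

theorem expect_congr {f g : A → EReal} (h : f =ᵐ[μ] g) : expect μ f = expect μ g :=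
  le_antisymm (expect_mono h.le) (expect_mono h.symm.le)

theorem toENNReal_coe_sub_coe_neg (a : EReal) :
    ((a.toENNReal : ENNReal) : EReal) - (((-a).toENNReal : ENNReal) : EReal) = a := by
  induction a with
  | bot => simp
  | top => simp
  | coe r =>
    rcases le_total 0 r with h | h
    · rw [EReal.coe_toENNReal (by exact_mod_cast h), EReal.toENNReal_of_nonpos (x := -(r : EReal))]
      · simp
      · rw [EReal.neg_le, neg_zero]; exact_mod_cast h
    · rw [EReal.toENNReal_of_nonpos (x := (r : EReal)) (by exact_mod_cast h),
        EReal.coe_toENNReal]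
      · simp
      · rw [EReal.le_neg, neg_zero]; exact_mod_cast h

@[simp] theorem expect_const [IsProbabilityMeasure μ] (c : EReal) :
    expect μ (fun _ => c) = c := by
  by_cases h : c = ⊤
  · subst h
    exact expect_of_eq_top (by simp)
  · rw [expect_of_ne_top]
    · simp [toENNReal_coe_sub_coe_neg]
    · simpa using h

theorem expect_map {f : B → EReal} {φ : A → B} (hφ : Measurable φ)
    (hf : AEMeasurable f (μ.map φ)) : expect (μ.map φ) f = expect μ (fun a => f (φ a)) := by
  unfold expect
  rw [lintegral_map' hf.ereal_toENNReal hφ.aemeasurable,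
    lintegral_map' (by exact (measurable_neg.comp_aemeasurable hf).ereal_toENNReal) hφ.aemeasurable]

theorem hasExpectation_map_iff {f : B → EReal} {φ : A → B} (hφ : Measurable φ)
    (hf : Measurable f) : HasExpectation (μ.map φ) f ↔ HasExpectation μ fun a => f (φ a) := by
  have hneg : Measurable fun b => (-f b).toENNReal := (measurable_neg.comp hf).ereal_toENNReal
  unfold HasExpectation
  rw [lintegral_map hf.ereal_toENNReal hφ, lintegral_map hneg hφ]
  exact and_congr_left fun _ => iff_of_true hf.aemeasurable (hf.comp hφ).aemeasurable

/-- The identity `f⁺ + b = f⁻ + a` for `f = a - b`: it is free of subtractions, and can be integrated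
in `ℝ≥0∞`. -/
theorem toENNReal_add_eq_of_eq_sub {a b : ENNReal} (ha : a ≠ ⊤ ∨ b ≠ ⊤) :
    ((a : EReal) - (b : EReal)).toENNReal + b = (-((a : EReal) - (b : EReal))).toENNReal + a := by
  induction a with
  | top =>
    have hb : b ≠ ⊤ := by simpa using ha
    lift b to NNReal using hb
    have : ((⊤ : ENNReal) : EReal) - ((b : ENNReal) : EReal) = ⊤ := by
      rw [EReal.coe_ennreal_top]
      exact EReal.top_sub (by simp)
    rw [this]; simp
  | coe a =>
    induction b with
    | top => simp
    | coe b =>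
      have h : (((a : ENNReal) : EReal) - ((b : ENNReal) : EReal)) = ((a - b : ℝ) : EReal) := by
        rw [EReal.coe_sub]; rfl
      rw [h, ← EReal.coe_neg, EReal.toENNReal_of_ne_top (EReal.coe_ne_top _),
        EReal.toENNReal_of_ne_top (EReal.coe_ne_top _), EReal.toReal_coe, EReal.toReal_coe,
        ← ENNReal.ofReal_coe_nnreal (p := b), ← ENNReal.ofReal_coe_nnreal (p := a)]
      rcases le_total (a : ℝ) b with hab | hab
      · rw [ENNReal.ofReal_of_nonpos (p := (a : ℝ) - b) (by linarith), zero_add,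
          ← ENNReal.ofReal_add (by linarith) a.coe_nonneg]
        congr 1; ring
      · rw [ENNReal.ofReal_of_nonpos (p := -((a : ℝ) - b)) (by linarith), zero_add,
          ← ENNReal.ofReal_add (by linarith) b.coe_nonneg]
        congr 1; ring

/-- The expectation may be computed from any decomposition `f = a - b` into nonnegative parts that
do not both have infinite integral. -/
theorem expect_eq_of_eq_sub {f : A → EReal} {a b : A → ENNReal} (ha : AEMeasurable a μ)
    (hb : AEMeasurable b μ) (hf : f =ᵐ[μ] fun x => (a x : EReal) - (b x : EReal))
    (h : ∫⁻ x, a x ∂μ ≠ ⊤ ∨ ∫⁻ x, b x ∂μ ≠ ⊤) :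
    expect μ f = if ∫⁻ x, a x ∂μ = ⊤ then ⊤ else
      ((∫⁻ x, a x ∂μ : ENNReal) : EReal) - ((∫⁻ x, b x ∂μ : ENNReal) : EReal) := by
  rw [expect_congr hf]
  set g : A → EReal := fun x => (a x : EReal) - (b x : EReal) with hg
  have hpt : ∀ᵐ x ∂μ, (g x).toENNReal + b x = (-g x).toENNReal + a x := by
    rcases h with h | h
    · filter_upwards [ae_lt_top' ha h] with x hx
      exact toENNReal_add_eq_of_eq_sub (Or.inl hx.ne)
    · filter_upwards [ae_lt_top' hb h] with x hx
      exact toENNReal_add_eq_of_eq_sub (Or.inr hx.ne)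
  have hint : ∫⁻ x, (g x).toENNReal ∂μ + ∫⁻ x, b x ∂μ
      = ∫⁻ x, (-g x).toENNReal ∂μ + ∫⁻ x, a x ∂μ := by
    rw [← lintegral_add_right' _ hb, ← lintegral_add_right' _ ha]
    exact lintegral_congr_ae hpt
  have hgp : ∀ x, (g x).toENNReal ≤ a x := fun x => by
    rw [← EReal.toENNReal_coe (x := a x)]
    refine EReal.toENNReal_le_toENNReal ?_
    calc g x ≤ (a x : EReal) - 0 := EReal.sub_le_sub le_rfl (EReal.coe_ennreal_nonneg _)
      _ = a x := by simp
  have hgm : ∀ x, (-g x).toENNReal ≤ b x := fun x => by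
    rw [← EReal.toENNReal_coe (x := b x)]
    refine EReal.toENNReal_le_toENNReal ?_
    rw [EReal.neg_le]
    calc -(b x : EReal) = 0 - (b x : EReal) := by simp
      _ ≤ g x := EReal.sub_le_sub (EReal.coe_ennreal_nonneg _) le_rfl
  have hgp' := lintegral_mono (μ := μ) hgp
  have hgm' := lintegral_mono (μ := μ) hgm
  split_ifs with htop
  · have hb' : ∫⁻ x, b x ∂μ ≠ ⊤ := by simpa [htop] using h
    refine expect_of_eq_top ?_
    rw [htop, add_top] at hint
    exact (ENNReal.add_eq_top.mp hint).resolve_right hb'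
  · have hp : ∫⁻ x, (g x).toENNReal ∂μ ≠ ⊤ := ne_top_of_le_ne_top htop hgp'
    rw [expect_of_ne_top hp]
    generalize ∫⁻ x, (g x).toENNReal ∂μ = p at *
    generalize ∫⁻ x, (-g x).toENNReal ∂μ = q at *
    generalize ∫⁻ x, a x ∂μ = a' at *
    generalize ∫⁻ x, b x ∂μ = b' at *
    lift p to NNReal using hp
    lift a' to NNReal using htop
    by_cases hb' : b' = ⊤
    · subst hb'
      have : q = ⊤ := by simpa [ENNReal.add_eq_top] using hint.symm
      simp [this]
    · have hq : q ≠ ⊤ := ne_top_of_le_ne_top hb' hgm'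
      lift b' to NNReal using hb'
      lift q to NNReal using hq
      have h' : (p : ℝ) + b' = q + a' := by exact_mod_cast hint
      change ((p : ℝ) : EReal) - ((q : ℝ) : EReal) = ((a' : ℝ) : EReal) - ((b' : ℝ) : EReal)
      rw [← EReal.coe_sub, ← EReal.coe_sub, EReal.coe_eq_coe_iff]
      linarith

theorem measurable_expect [SFinite ν] {f : A × B → EReal} (hf : Measurable f) :
    Measurable fun a => expect ν fun b => f (a, b) := by
  unfold expect
  have h1 : Measurable fun a => ∫⁻ b, (f (a, b)).toENNReal ∂ν :=
    hf.ereal_toENNReal.lintegral_prod_right'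
  have h2 : Measurable fun a => ∫⁻ b, (-f (a, b)).toENNReal ∂ν :=
    (measurable_neg.comp hf).ereal_toENNReal.lintegral_prod_right'
  refine Measurable.ite (h1 (measurableSet_singleton ⊤)) measurable_const ?_
  simp only [sub_eq_add_neg]
  exact h1.coe_ereal_ennreal.add h2.coe_ereal_ennreal.neg

/-- Fubini's theorem for `expect`. It requires that the positive and the negative part do not both have
infinite integral. -/
theorem expect_prod [SFinite μ] [SFinite ν] {f : A × B → EReal} (hf : Measurable f)
    (h : ∫⁻ z, (f z).toENNReal ∂μ.prod ν ≠ ⊤ ∨ ∫⁻ z, (-f z).toENNReal ∂μ.prod ν ≠ ⊤) :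
    expect (μ.prod ν) f = expect μ fun a => expect ν fun b => f (a, b) := by
  have h1 : Measurable fun a => ∫⁻ b, (f (a, b)).toENNReal ∂ν :=
    hf.ereal_toENNReal.lintegral_prod_right'
  have h2 : Measurable fun a => ∫⁻ b, (-f (a, b)).toENNReal ∂ν :=
    (measurable_neg.comp hf).ereal_toENNReal.lintegral_prod_right'
  have e1 := lintegral_prod (μ := μ) (ν := ν) _ hf.ereal_toENNReal.aemeasurable
  have e2 := lintegral_prod (μ := μ) (ν := ν) _
    (measurable_neg.comp hf).ereal_toENNReal.aemeasurable
  simp only [Function.comp_def] at e2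
  rw [e1, e2] at h
  rw [expect_eq_of_eq_sub (f := fun a => expect ν fun b => f (a, b)) h1.aemeasurable
    h2.aemeasurable ?_ h]
  · unfold expect
    rw [e1, e2]
  · rcases h with h | h
    · filter_upwards [ae_lt_top' h1.aemeasurable h] with a ha
      exact expect_of_ne_top ha.ne
    · filter_upwards [ae_lt_top' h2.aemeasurable h] with a ha
      by_cases ht : ∫⁻ b, (f (a, b)).toENNReal ∂ν = ⊤
      · rw [expect_of_eq_top ht, ht, EReal.coe_ennreal_top, EReal.top_sub]
        simpa using ha.ne
      · exact expect_of_ne_top ht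

/-- The condition that `f` avoids `-∞` matters for `c = +∞`, because `⊤ + ⊥ = ⊥` in `EReal`. -/
theorem expect_const_add [IsProbabilityMeasure μ] {c : EReal} (hc : c ≠ ⊥) {f : A → EReal}
    (hf : Measurable f) (hbot : ∀ a, f a ≠ ⊥) :
    expect μ (fun a => c + f a) = upperAdd c (expect μ f) := by
  induction c with
  | bot => exact absurd rfl hc
  | top => simp [EReal.top_add_of_ne_bot (hbot _)]
  | coe r =>
    rw [upperAdd_coe]
    by_cases htop : ∫⁻ a, (f a).toENNReal ∂μ = ⊤
    · rw [expect_of_eq_top htop, EReal.coe_add_top]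
      refine expect_of_eq_top ?_
      have hle : ∀ a, (f a).toENNReal ≤ ((r : EReal) + f a).toENNReal + (-(r : EReal)).toENNReal := by
        intro a
        refine le_trans (EReal.toENNReal_le_toENNReal (le_of_eq ?_)) EReal.toENNReal_add_le
        rw [← sub_eq_add_neg, add_comm, EReal.add_sub_cancel_right]
      have := lintegral_mono (μ := μ) hle
      rw [htop, lintegral_add_right _ measurable_const, top_le_iff, ENNReal.add_eq_top] at this
      refine this.resolve_right ?_
      simp [← EReal.coe_neg]
    · rw [expect_eq_of_eq_sub (a := fun a => (r : EReal).toENNReal + (f a).toENNReal)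
        (b := fun a => (-(r : EReal)).toENNReal + (-f a).toENNReal)
        (by fun_prop) (by fun_prop)]
      · rw [lintegral_add_left measurable_const, lintegral_add_left measurable_const, if_neg,
          expect_of_ne_top htop]
        · simp only [lintegral_const, measure_univ, mul_one, EReal.coe_ennreal_add]
          rw [EReal.add_sub_add_comm (Or.inl (EReal.coe_ennreal_ne_bot _))
            (Or.inr (EReal.coe_ennreal_ne_bot _)), toENNReal_coe_sub_coe_neg]
        · simp [htop]
      · refine Eventually.of_forall fun a => ?_
        simp only [EReal.coe_ennreal_add]
        rw [EReal.add_sub_add_comm (Or.inl (EReal.coe_ennreal_ne_bot _))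
            (Or.inr (EReal.coe_ennreal_ne_bot _)), toENNReal_coe_sub_coe_neg,
            toENNReal_coe_sub_coe_neg]
      · left
        rw [lintegral_add_left measurable_const]
        simp [htop]

end Expectation

/-! ### Approximation of the expectation of an infimum -/

/-- The level `max (v + 1 / (m + 1)) (-m)`: being below it means being `1 / (m + 1)`-close to the
infimum `v`, or very negative in case `v = -∞`. -/
noncomputable def nearLevel (m : ℕ) (v : EReal) : EReal :=
  max (v + ((1 / ((m : ℝ) + 1) : ℝ) : EReal)) ((-(m : ℝ) : ℝ) : EReal)

theorem lt_nearLevel (m : ℕ) {v : EReal} (hv : v ≠ ⊤) : v < nearLevel m v := by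
  induction v with
  | bot => exact lt_max_of_lt_right (EReal.bot_lt_coe _)
  | top => exact absurd rfl hv
  | coe r =>
    refine lt_max_of_lt_left ?_
    rw [← EReal.coe_add, EReal.coe_lt_coe_iff]
    have : (0 : ℝ) < 1 / ((m : ℝ) + 1) := by positivity
    linarith

@[simp] theorem nearLevel_top (m : ℕ) : nearLevel m ⊤ = ⊤ := by
  simp [nearLevel]

theorem measurable_nearLevel (m : ℕ) : Measurable (nearLevel m) := by
  unfold nearLevel
  fun_prop

theorem antitone_nearLevel (v : EReal) : Antitone fun m => nearLevel m v := by
  intro m n hmn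
  have h : (m : ℝ) ≤ n := by exact_mod_cast hmn
  refine max_le_max ?_ ?_
  · gcongr
  · rw [EReal.coe_le_coe_iff]; linarith

theorem tendsto_nearLevel (v : EReal) : Tendsto (fun m => nearLevel m v) atTop (𝓝 v) := by
  have h1 : Tendsto (fun m : ℕ => v + ((1 / ((m : ℝ) + 1) : ℝ) : EReal)) atTop (𝓝 (v + (0 : ℝ))) :=
    (EReal.continuousAt_add (p := (v, ((0 : ℝ) : EReal))) (by simp) (by simp)).tendsto.comp
      (tendsto_const_nhds.prodMk_nhds
        ((continuous_coe_real_ereal.tendsto 0).comp tendsto_one_div_add_atTop_nhds_zero_nat))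
  have h2 : Tendsto (fun m : ℕ => ((-(m : ℝ) : ℝ) : EReal)) atTop (𝓝 ⊥) :=
    EReal.tendsto_coe_nhds_bot_iff.mpr
      (tendsto_neg_atTop_atBot.comp tendsto_natCast_atTop_atTop)
  simpa [nearLevel] using h1.max h2

/-- If `f m` is below the level `nearLevel m` of `v` for every `m`, its expectations come
arbitrarily close to the one of `v`. No lower bound on `v` is needed: `E[v]` may be `-∞`. -/
theorem iInf_expect_le {A : Type*} [MeasurableSpace A] {μ : Measure A} [IsProbabilityMeasure μ]
    {v : A → EReal} (hv : AEMeasurable v μ) {f : ℕ → A → EReal}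
    (hf : ∀ m, f m ≤ᵐ[μ] fun a => nearLevel m (v a)) : ⨅ m, expect μ (f m) ≤ expect μ v := by
  by_cases htop : ∫⁻ a, (v a).toENNReal ∂μ = ⊤
  · rw [expect_of_eq_top htop]; exact le_top
  set e : ℕ → ENNReal := fun m => ENNReal.ofReal (1 / ((m : ℝ) + 1)) with he
  have hpos : ∀ m, ∫⁻ a, (nearLevel m (v a)).toENNReal ∂μ ≤ ∫⁻ a, (v a).toENNReal ∂μ + e m := by
    intro m
    calc ∫⁻ a, (nearLevel m (v a)).toENNReal ∂μ ≤ ∫⁻ a, ((v a).toENNReal + e m) ∂μ := by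
          refine lintegral_mono fun a => ?_
          rcases max_choice (v a + ((1 / ((m : ℝ) + 1) : ℝ) : EReal)) ((-(m : ℝ) : ℝ) : EReal)
            with h | h
          · rw [nearLevel, h]
            refine EReal.toENNReal_add_le.trans (le_of_eq ?_)
            rw [EReal.toENNReal_of_ne_top (EReal.coe_ne_top _), EReal.toReal_coe]
          · rw [nearLevel, h, EReal.toENNReal_of_nonpos]
            · exact zero_le
            · rw [← EReal.coe_zero, EReal.coe_le_coe_iff]
              simp
      _ = _ := by rw [lintegral_add_right _ measurable_const]; simp
  have hneg : Tendsto (fun m => ∫⁻ a, (-nearLevel m (v a)).toENNReal ∂μ) atTop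
      (𝓝 (∫⁻ a, (-v a).toENNReal ∂μ)) := by
    refine lintegral_tendsto_of_tendsto_of_monotone (fun m => ?_) ?_ ?_
    · exact ((measurable_neg.comp (measurable_nearLevel m)).comp_aemeasurable hv).ereal_toENNReal
    · exact Eventually.of_forall fun a m n hmn => EReal.toENNReal_le_toENNReal
        (EReal.neg_le_neg_iff.mpr (antitone_nearLevel (v a) hmn))
    · refine Eventually.of_forall fun a => ?_
      exact (EReal.continuous_toENNReal.tendsto _).comp
        ((continuous_neg.tendsto _).comp (tendsto_nearLevel (v a)))
  have hle : ∀ m, expect μ (f m) ≤ ((∫⁻ a, (v a).toENNReal ∂μ + e m : ENNReal) : EReal)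
      - ((∫⁻ a, (-nearLevel m (v a)).toENNReal ∂μ : ENNReal) : EReal) := by
    intro m
    have hne : ∫⁻ a, (v a).toENNReal ∂μ + e m ≠ ⊤ := by simp [htop, he]
    refine (expect_mono (hf m)).trans ?_
    rw [expect_of_ne_top (ne_top_of_le_ne_top hne (hpos m))]
    exact EReal.sub_le_sub (by exact_mod_cast hpos m) le_rfl
  have he0 : Tendsto e atTop (𝓝 0) := by
    simpa [he] using ENNReal.tendsto_ofReal tendsto_one_div_add_atTop_nhds_zero_nat
  have hlim1 : Tendsto (fun m => ((∫⁻ a, (v a).toENNReal ∂μ + e m : ENNReal) : EReal)) atTop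
      (𝓝 ((∫⁻ a, (v a).toENNReal ∂μ : ENNReal) : EReal)) := by
    refine (continuous_coe_ennreal_ereal.tendsto _).comp ?_
    simpa using tendsto_const_nhds.add he0
  have hlim2 := ((continuous_neg.comp continuous_coe_ennreal_ereal).tendsto _).comp hneg
  rw [expect_of_ne_top htop]
  refine ge_of_tendsto' (b := ⨅ m, expect μ (f m)) (f := fun m =>
    ((∫⁻ a, (v a).toENNReal ∂μ + e m : ENNReal) : EReal)
      - ((∫⁻ a, (-nearLevel m (v a)).toENNReal ∂μ : ENNReal) : EReal)) (x := atTop) ?_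
    fun m => (iInf_le _ m).trans (hle m)
  simp only [sub_eq_add_neg]
  refine (EReal.continuousAt_add (p := (((∫⁻ a, (v a).toENNReal ∂μ : ENNReal) : EReal),
    -((∫⁻ a, (-v a).toENNReal ∂μ : ENNReal) : EReal))) (Or.inl ?_) (Or.inl ?_)).tendsto.comp
    (hlim1.prodMk_nhds hlim2)
  · simpa using htop
  · simp

/-! ### Measurable choice of branches -/

section Selection

variable {Y Z : Type*} [MeasurableSpace Y] [MeasurableSpace Z]

/-- A measurable subset of a product only involves countably many measurable subsets of the first
factor, which can therefore be replaced by the Cantor space. -/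
theorem exists_preimage_cantor {B : Set (Y × Z)} (hB : MeasurableSet B) :
    ∃ (f : Y → ℕ → Bool) (B' : Set ((ℕ → Bool) × Z)), Measurable f ∧ MeasurableSet B' ∧
      B = (fun p => (f p.1, p.2)) ⁻¹' B' := by
  rw [← generateFrom_prod] at hB
  induction B, hB using MeasurableSpace.generateFrom_induction with
  | hC s hs _ =>
    obtain ⟨M, hM, N, hN, rfl⟩ := hs
    classical
    refine ⟨fun y _ => decide (y ∈ M), {c | c 0 = true} ×ˢ N, ?_, ?_, ?_⟩
    · exact measurable_pi_lambda _ fun _ =>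
        measurable_to_bool (by simpa [Set.preimage] using hM)
    · exact ((measurable_pi_apply (X := fun _ : ℕ => Bool) 0)
        (measurableSet_singleton true)).prod hN
    · ext p; simp
  | empty => exact ⟨fun _ _ => true, ∅, measurable_const, .empty, by simp⟩
  | compl s _ ih =>
    obtain ⟨f, B', hf, hB', rfl⟩ := ih
    exact ⟨f, B'ᶜ, hf, hB'.compl, by simp⟩
  | iUnion s _ ih =>
    choose f B' hf hB' hs using ih
    refine ⟨fun y n => f n.unpair.1 y n.unpair.2,
      ⋃ k, (fun p : (ℕ → Bool) × Z => ((fun n => p.1 (Nat.pair k n)), p.2)) ⁻¹' B' k,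
      ?_, ?_, ?_⟩
    · exact measurable_pi_lambda _ fun n => (measurable_pi_apply _).comp (hf _)
    · exact .iUnion fun k => (by fun_prop : Measurable
        fun p : (ℕ → Bool) × Z => ((fun n => p.1 (Nat.pair k n)), p.2)) (hB' k)
    · ext p
      simp only [Set.mem_iUnion, Set.mem_preimage, Nat.unpair_pair, hs]

/-- A measurable choice of a branch in a tree which depends measurably on a parameter: `Hit k b` is
the set of parameters for which the tree has an infinite branch that starts with `b`. -/
theorem exists_measurable_branch {Hit : ∀ k, (Fin k → ℕ) → Set Y}
    (hmeas : ∀ k b, MeasurableSet (Hit k b))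
    (hext : ∀ k b, ∀ y ∈ Hit k b, ∃ j, y ∈ Hit (k + 1) (Fin.snoc b j)) :
    ∃ S : Y → ℕ → ℕ, Measurable S ∧
      ∀ y ∈ Hit 0 Fin.elim0, ∀ k, y ∈ Hit k fun i => S y i := by
  let s : ∀ k, Y → Fin k → ℕ := fun k => Nat.rec (fun _ => Fin.elim0)
    (fun k sk y => Fin.snoc (sk y) (sInf {j | y ∈ Hit (k + 1) (Fin.snoc (sk y) j)})) k
  have hs0 : ∀ y, s 0 y = Fin.elim0 := fun _ => rfl
  have hs1 : ∀ k y, s (k + 1) y =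
    Fin.snoc (s k y) (sInf {j | y ∈ Hit (k + 1) (Fin.snoc (s k y) j)}) := fun _ _ => rfl
  clear_value s
  have hsm : ∀ k, Measurable (s k) := by
    intro k
    induction k with
    | zero => exact measurable_of_subsingleton_codomain _
    | succ k ih =>
      have hM : ∀ j, MeasurableSet {y | y ∈ Hit (k + 1) (Fin.snoc (s k y) j)} := by
        intro j
        have : {y | y ∈ Hit (k + 1) (Fin.snoc (s k y) j)}
            = ⋃ b, s k ⁻¹' {b} ∩ Hit (k + 1) (Fin.snoc b j) := by
          ext y; simp
        rw [this]
        exact .iUnion fun b => (ih (measurableSet_singleton b)).inter (hmeas _ _)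
      have hj : Measurable fun y => sInf {j | y ∈ Hit (k + 1) (Fin.snoc (s k y) j)} := by
        refine measurable_of_Iic fun m => ?_
        have : (fun y => sInf {j | y ∈ Hit (k + 1) (Fin.snoc (s k y) j)}) ⁻¹' Set.Iic m
            = (⋃ j ∈ Set.Iic m, {y | y ∈ Hit (k + 1) (Fin.snoc (s k y) j)})
              ∪ (⋃ j, {y | y ∈ Hit (k + 1) (Fin.snoc (s k y) j)})ᶜ := by
          ext y
          simp only [Set.mem_preimage, Set.mem_Iic, Set.mem_union, Set.mem_iUnion, Set.mem_ofPred_eq,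
            Set.mem_compl_iff, exists_prop]
          constructor
          · intro h
            by_cases hne : {j | y ∈ Hit (k + 1) (Fin.snoc (s k y) j)}.Nonempty
            · exact Or.inl ⟨_, h, Nat.sInf_mem hne⟩
            · exact Or.inr hne
          · rintro (⟨j, hj, hy⟩ | h)
            · exact (Nat.sInf_le hy).trans hj
            · have : {j | y ∈ Hit (k + 1) (Fin.snoc (s k y) j)} = ∅ :=
                Set.not_nonempty_iff_eq_empty.mp h
              simp [this]
        rw [this]
        exact (MeasurableSet.biUnion (Set.to_countable _) fun j _ => hM j).union
          (MeasurableSet.iUnion hM).compl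
      rw [show s (k + 1) = _ from funext (hs1 k)]
      refine measurable_pi_lambda _ fun i => ?_
      refine Fin.lastCases ?_ (fun i => ?_) i
      · simpa using hj
      · simpa [Function.comp_def] using (measurable_pi_apply i).comp ih
  have hhit : ∀ y ∈ Hit 0 Fin.elim0, ∀ k, y ∈ Hit k (s k y) := by
    intro y hy k
    induction k with
    | zero => rw [hs0]; exact hy
    | succ k ih =>
      rw [hs1]
      exact Nat.sInf_mem (s := {j | y ∈ Hit (k + 1) (Fin.snoc (s k y) j)}) (hext k _ y ih)
  have hcoh : ∀ y k (i : Fin k), s (i + 1) y (Fin.last i) = s k y i := by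
    intro y k
    induction k with
    | zero => exact fun i => i.elim0
    | succ k ih =>
      intro i
      refine Fin.lastCases ?_ (fun i => ?_) i
      · rfl
      · rw [hs1 k]
        simpa using ih i
  refine ⟨fun y i => s (i + 1) y (Fin.last i),
    measurable_pi_lambda _ fun i => (measurable_pi_apply _).comp (hsm _), fun y hy k => ?_⟩
  have : (fun i : Fin k => s (i + 1) y (Fin.last i)) = s k y := funext (hcoh y k)
  rw [this]
  exact hhit y hy k

end Selection

/-! ### Souslin schemes -/

section Selection

variable {Y : Type*} [MeasurableSpace Y]

/-- A tree of measurable sets, indexed by the finite sequences of natural numbers: `R n τ` is the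
set attached to the first `n` terms of the infinite sequence `τ`. -/
structure IsSouslinScheme (R : ℕ → (ℕ → ℕ) → Set Y) : Prop where
  congr : ∀ {n τ τ'}, (∀ i < n, τ i = τ' i) → R n τ = R n τ'
  measurableSet : ∀ n τ, MeasurableSet (R n τ)
  antitone : ∀ τ, Antitone fun n => R n τ

namespace IsSouslinScheme

variable {R : ℕ → (ℕ → ℕ) → Set Y}

theorem isClosed_setOf_mem (hR : IsSouslinScheme R) (n : ℕ) (y : Y) :
    IsClosed {τ | y ∈ R n τ} := by
  rw [← isOpen_compl_iff, isOpen_iff_mem_nhds]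
  intro τ hτ
  filter_upwards [(PiNat.isOpen_cylinder (fun _ => ℕ) τ n).mem_nhds (PiNat.self_mem_cylinder τ n)]
    with τ' h
  have h' : R n τ' = R n τ := hR.congr fun i hi => h i hi
  simpa [h'] using hτ

theorem isClosed_prefix {k : ℕ} (b : Fin k → ℕ) : IsClosed {τ : ℕ → ℕ | ∀ i : Fin k, τ i = b i} := by
  simp only [Set.ofPred_forall]
  exact isClosed_iInter fun i => isClosed_eq (continuous_apply _) continuous_const

/-- By compactness of `{τ | τ ≤ σ}`, a tree that is finitely branching below `σ` has an infinite
branch as soon as it has arbitrarily long ones. -/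
theorem exists_branch_iff (hR : IsSouslinScheme R) {k : ℕ} (b : Fin k → ℕ) (y : Y) (σ : ℕ → ℕ) :
    (∃ τ ≤ σ, (∀ i : Fin k, τ i = b i) ∧ ∀ n, y ∈ R n τ) ↔
      ∀ n, ∃ τ ≤ σ, (∀ i : Fin k, τ i = b i) ∧ y ∈ R n τ := by
  refine ⟨fun ⟨τ, h1, h2, h3⟩ n => ⟨τ, h1, h2, h3 n⟩, fun h => ?_⟩
  let t : ℕ → Set (ℕ → ℕ) := fun n => Set.Icc 0 σ ∩ ({τ | ∀ i : Fin k, τ i = b i} ∩ {τ | y ∈ R n τ})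
  have hcl : ∀ n, IsClosed (t n) := fun n =>
    isClosed_Icc.inter ((isClosed_prefix b).inter (hR.isClosed_setOf_mem n y))
  obtain ⟨τ, hτ⟩ := IsCompact.nonempty_iInter_of_sequence_nonempty_isCompact_isClosed t
    (fun n τ hτ => ⟨hτ.1, hτ.2.1, hR.antitone τ (Nat.le_succ n) hτ.2.2⟩)
    (fun n => by
      obtain ⟨τ, h1, h2, h3⟩ := h n
      exact ⟨τ, ⟨fun _ => Nat.zero_le _, h1⟩, h2, h3⟩)
    (isCompact_Icc.inter_right ((isClosed_prefix b).inter (hR.isClosed_setOf_mem 0 y))) hcl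
  rw [Set.mem_iInter] at hτ
  exact ⟨τ, (hτ 0).1.2, (hτ 0).2.1, fun n => (hτ n).2.2⟩

theorem measurableSet_exists_le (hR : IsSouslinScheme R) {k : ℕ} (b : Fin k → ℕ) (n : ℕ) :
    MeasurableSet {p : Y × (ℕ → ℕ) | ∃ τ ≤ p.2, (∀ i : Fin k, τ i = b i) ∧ p.1 ∈ R n τ} := by
  -- only finitely many terms of `τ` matter; the others may be replaced by `0`
  let ext : (Fin (max k n) → ℕ) → ℕ → ℕ := fun c i => if h : i < max k n then c ⟨i, h⟩ else 0
  have : {p : Y × (ℕ → ℕ) | ∃ τ ≤ p.2, (∀ i : Fin k, τ i = b i) ∧ p.1 ∈ R n τ}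
      = ⋃ c, ⋃ (_ : ∀ i : Fin k, ext c i = b i), R n (ext c) ×ˢ Set.Ici (ext c) := by
    ext p
    simp only [Set.mem_ofPred_eq, Set.mem_iUnion, Set.mem_prod, Set.mem_Ici, exists_prop]
    constructor
    · rintro ⟨τ, h1, h2, h3⟩
      have hτ : ∀ i < max k n, ext (fun j => τ j) i = τ i := fun i hi => dif_pos hi
      refine ⟨fun j => τ j, fun i => ?_, ?_, fun i => ?_⟩
      · rw [hτ i (i.2.trans_le (le_max_left _ _)), h2]
      · rwa [hR.congr fun i hi => hτ i (hi.trans_le (le_max_right _ _))]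
      · by_cases hi : i < max k n
        · rw [hτ i hi]; exact h1 i
        · exact (dif_neg hi).trans_le (Nat.zero_le _)
    · rintro ⟨c, h1, h2, h3⟩
      exact ⟨ext c, h3, h1, h2⟩
  rw [this]
  exact .iUnion fun c => .iUnion fun _ => (hR.measurableSet _ _).prod isClosed_Ici.measurableSet

theorem measurableSet_exists_branch (hR : IsSouslinScheme R) {k : ℕ} (b : Fin k → ℕ) :
    MeasurableSet {p : Y × (ℕ → ℕ) | ∃ τ ≤ p.2, (∀ i : Fin k, τ i = b i) ∧ ∀ n, p.1 ∈ R n τ} := by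
  simp only [hR.exists_branch_iff, Set.ofPred_forall]
  exact .iInter fun n => hR.measurableSet_exists_le b n

/-- A measurable choice of a branch below `σ`, as a function of the point `y` and of `σ`. -/
theorem exists_measurable_branch_le (hR : IsSouslinScheme R) :
    ∃ S : Y × (ℕ → ℕ) → ℕ → ℕ, Measurable S ∧
      ∀ y σ, (∃ τ ≤ σ, ∀ n, y ∈ R n τ) → ∀ n, y ∈ R n (S (y, σ)) := by
  obtain ⟨S, hS, h⟩ := exists_measurable_branch
    (Hit := fun k b => {p : Y × (ℕ → ℕ) | ∃ τ ≤ p.2, (∀ i : Fin k, τ i = b i) ∧ ∀ n, p.1 ∈ R n τ})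
    (fun k b => hR.measurableSet_exists_branch b) (by
      rintro k b ⟨y, σ⟩ ⟨τ, h1, h2, h3⟩
      refine ⟨τ k, τ, h1, fun i => ?_, h3⟩
      refine Fin.lastCases ?_ (fun i => ?_) i
      · simp
      · simpa using h2 i)
  refine ⟨S, hS, fun y σ hy n => ?_⟩
  obtain ⟨τ, h1, h2⟩ := hy
  obtain ⟨τ', -, h3, h4⟩ := h (y, σ) ⟨τ, h1, fun i => i.elim0, h2⟩ n
  rw [← hR.congr fun i hi => h3 ⟨i, hi⟩]
  exact h4 n

/-- Capacitability: the set of all points that have a branch is approximated from inside, in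
measure, by the sets of the points that have a branch below some fixed `σ`. -/
theorem exists_le_measure (hR : IsSouslinScheme R) (P : Measure Y) [IsFiniteMeasure P]
    {c : ENNReal} (hc : c < P {y | ∃ τ, ∀ n, y ∈ R n τ}) :
    ∃ σ : ℕ → ℕ, c ≤ P {y | ∃ τ ≤ σ, ∀ n, y ∈ R n τ} := by
  -- `σ` is constructed term by term, using that outer measures are continuous along increasing
  -- sequences of arbitrary sets
  let G : ∀ k, (Fin k → ℕ) → Set Y := fun k b => {y | ∃ τ, (∀ i : Fin k, τ i ≤ b i) ∧ ∀ n, y ∈ R n τ}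
  obtain ⟨S, -, hS⟩ := exists_measurable_branch (Y := Unit)
    (Hit := fun k b => {_u | c < P (G k b)}) (fun _ _ => .of_discrete) (by
      intro k b _ hb
      have hU : G k b = ⋃ j, G (k + 1) (Fin.snoc b j) := by
        ext y
        simp only [G, Set.mem_ofPred_eq, Set.mem_iUnion, Fin.forall_fin_succ', Fin.snoc_castSucc,
          Fin.snoc_last, Fin.val_castSucc, Fin.val_last]
        exact ⟨fun ⟨τ, h1, h2⟩ => ⟨τ k, τ, ⟨h1, le_rfl⟩, h2⟩, fun ⟨_, τ, h1, h2⟩ => ⟨τ, h1.1, h2⟩⟩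
      have hm : Monotone fun j => G (k + 1) (Fin.snoc b j) := by
        intro j j' hj y
        simp only [G, Set.mem_ofPred_eq, Fin.forall_fin_succ', Fin.snoc_castSucc,
          Fin.snoc_last, Fin.val_castSucc, Fin.val_last]
        exact fun ⟨τ, h1, h2⟩ => ⟨τ, ⟨h1.1, h1.2.trans hj⟩, h2⟩
      simp only [Set.mem_ofPred_eq, hU, hm.measure_iUnion, lt_iSup_iff] at hb
      exact hb)
  have hS := hS () (by simpa [G] using hc)
  refine ⟨S (), ?_⟩
  have hmeas : ∀ n, MeasurableSet {y | ∃ τ ≤ S (), y ∈ R n τ} := fun n => by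
    simpa using measurable_prodMk_right (y := S ()) (hR.measurableSet_exists_le Fin.elim0 n)
  have hanti : Antitone fun n => {y | ∃ τ ≤ S (), y ∈ R n τ} := fun m n hmn y ⟨τ, h1, h2⟩ =>
    ⟨τ, h1, hR.antitone τ hmn h2⟩
  have hlim := tendsto_measure_iInter_atTop (μ := P) (fun n => (hmeas n).nullMeasurableSet) hanti
    ⟨0, measure_ne_top _ _⟩
  have heq : {y | ∃ τ ≤ S (), ∀ n, y ∈ R n τ} = ⋂ n, {y | ∃ τ ≤ S (), y ∈ R n τ} := by
    ext y
    simpa using hR.exists_branch_iff Fin.elim0 y (S ())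
  rw [heq]
  refine ge_of_tendsto' hlim fun n => (hS n).le.trans (measure_mono ?_)
  rintro y ⟨τ, h1, h2⟩
  refine ⟨fun i => if i < n then τ i else 0, fun i => ?_, ?_⟩
  · by_cases hi : i < n
    · simpa [hi] using h1 ⟨i, hi⟩
    · simp [hi]
  · rw [hR.congr (τ' := τ) fun i hi => by simp [hi]]
    exact h2 n

end IsSouslinScheme
end Selection

/-! ### Measurable selection of almost optimal points -/

section Selection

variable {Y : Type*} [MeasurableSpace Y]

/-- The projection of a measurable set along `ℕ → ℕ` is the set of the points that have a branch in
a Souslin scheme, and a branch determines a point of the fibre. -/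
theorem exists_souslinScheme {B : Set (Y × (ℕ → ℕ))} (hB : MeasurableSet B) (hne : B.Nonempty) :
    ∃ (R : ℕ → (ℕ → ℕ) → Set Y) (q : (ℕ → ℕ) → ℕ → ℕ), IsSouslinScheme R ∧ Measurable q ∧
      (∀ y τ, (∀ n, y ∈ R n τ) → (y, q τ) ∈ B) ∧
      ∀ y z, (y, z) ∈ B → ∃ τ, ∀ n, y ∈ R n τ := by
  obtain ⟨f, B', hf, hB', rfl⟩ := exists_preimage_cantor hB
  have hne' : B'.Nonempty := hne.elim fun _ hp => ⟨_, hp⟩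
  obtain ⟨h, hc, hr⟩ : ∃ h : (ℕ → ℕ) → (ℕ → Bool) × (ℕ → ℕ), Continuous h ∧ Set.range h = B' := by
    have := hB'.analyticSet_image measurable_id
    rw [Set.image_id, AnalyticSet] at this
    exact this.resolve_left hne'.ne_empty
  let R : ℕ → (ℕ → ℕ) → Set Y := fun n τ =>
    {y | ∃ τ' ∈ PiNat.cylinder τ n, ∀ i : Fin n, f y i = (h τ').1 i}
  have hR : ∀ y τ, (∀ n, y ∈ R n τ) ↔ f y = (h τ).1 := by
    refine fun y τ => ⟨fun hy => ?_, fun hy n => ⟨τ, PiNat.self_mem_cylinder τ n, by simp [hy]⟩⟩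
    funext m
    have hcm : Continuous fun τ => (h τ).1 m := by fun_prop
    have hopen : IsOpen {τ' | (h τ').1 m = (h τ).1 m} :=
      (isOpen_discrete {(h τ).1 m}).preimage hcm
    obtain ⟨_, ⟨x, n, rfl⟩, hτ, hsub⟩ :=
      (PiNat.isTopologicalBasis_cylinders (fun _ : ℕ => ℕ)).exists_subset_of_mem_open
        (show τ ∈ {τ' | (h τ').1 m = (h τ).1 m} from rfl) hopen
    rw [← PiNat.mem_cylinder_iff_eq.mp hτ] at hsub
    obtain ⟨τ', h1, h2⟩ := hy (max n (m + 1))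
    rw [h2 ⟨m, (Nat.lt_succ_self m).trans_le (le_max_right _ _)⟩]
    exact hsub (PiNat.cylinder_anti τ (le_max_left _ _) h1)
  refine ⟨R, fun τ => (h τ).2, ⟨?_, ?_, ?_⟩, by fun_prop, ?_, ?_⟩
  · intro n τ τ' hτ
    have : PiNat.cylinder τ n = PiNat.cylinder τ' n :=
      PiNat.mem_cylinder_iff_eq.mp (PiNat.mem_cylinder_iff.mpr hτ)
    simp only [R, this]
  · intro n τ
    have hfn : Measurable fun y (i : Fin n) => f y i := by fun_prop
    exact hfn (t := {c | ∃ τ' ∈ PiNat.cylinder τ n, ∀ i : Fin n, c i = (h τ').1 i})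
      (Set.toFinite _).measurableSet
  · rintro τ m n hmn y ⟨τ', h1, h2⟩
    exact ⟨τ', PiNat.cylinder_anti τ hmn h1, fun i => h2 ⟨i, i.2.trans_le hmn⟩⟩
  · intro y τ hy
    rw [hR] at hy
    rw [Set.mem_preimage, ← hr, hy]
    exact ⟨τ, rfl⟩
  · intro y z hz
    rw [Set.mem_preimage, ← hr] at hz
    obtain ⟨τ, hτ⟩ := hz
    exact ⟨τ, (hR y τ).mpr (by rw [hτ])⟩

/-- Measurable selection in the fibres of a measurable set `B`, by means of a function `S` that
does not depend on a measure: an additional parameter, ranging over sequences of points of `ℕ → ℕ`,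
can be adjusted to any finite measure, in such a way that almost all nonempty fibres are served. -/
theorem exists_selector_of_measurableSet {B : Set (Y × (ℕ → ℕ))} (hB : MeasurableSet B) :
    ∃ (D : Set (Y × (ℕ → ℕ))) (S : Y × (ℕ → ℕ) → ℕ → ℕ), MeasurableSet D ∧ Measurable S ∧
      (∀ p ∈ D, (p.1, S p) ∈ B) ∧
      ∀ (P : Measure Y) [IsFiniteMeasure P], ∃ σ : ℕ → ℕ → ℕ,
        P ({y | ∃ z, (y, z) ∈ B} \ ⋃ k, {y | (y, σ k) ∈ D}) = 0 := by
  rcases B.eq_empty_or_nonempty with rfl | hne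
  · exact ⟨∅, fun _ => 0, .empty, measurable_const, by simp, fun P _ => ⟨fun _ => 0, by simp⟩⟩
  obtain ⟨R, q, hR, hq, hRB, hBR⟩ := exists_souslinScheme hB hne
  obtain ⟨S, hS, hSR⟩ := hR.exists_measurable_branch_le
  have hA : {y | ∃ z, (y, z) ∈ B} = {y | ∃ τ, ∀ n, y ∈ R n τ} := by
    ext y
    exact ⟨fun ⟨z, hz⟩ => hBR y z hz, fun ⟨τ, hτ⟩ => ⟨q τ, hRB y τ hτ⟩⟩
  have hD : MeasurableSet {p : Y × (ℕ → ℕ) | ∃ τ ≤ p.2, ∀ n, p.1 ∈ R n τ} := by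
    simpa using hR.measurableSet_exists_branch Fin.elim0
  refine ⟨{p | ∃ τ ≤ p.2, ∀ n, p.1 ∈ R n τ}, fun p => q (S p), hD, hq.comp hS, ?_, ?_⟩
  · rintro ⟨y, σ⟩ hy
    exact hRB y _ (hSR y σ hy)
  · intro P _
    rw [hA]
    set A : Set Y := {y | ∃ τ, ∀ n, y ∈ R n τ}
    by_cases h0 : P A = 0
    · exact ⟨fun _ => 0, measure_mono_null Set.sdiff_subset h0⟩
    obtain ⟨c, -, hc, hlim⟩ := exists_seq_strictMono_tendsto' (pos_iff_ne_zero.mpr h0)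
    choose σ hσ using fun k => hR.exists_le_measure P (hc k).2
    refine ⟨σ, ?_⟩
    set M : Set Y := ⋃ k, {y | ∃ τ ≤ σ k, ∀ n, y ∈ R n τ} with hM
    have hMm : MeasurableSet M := .iUnion fun k => measurable_prodMk_right (y := σ k) hD
    have hMA : M ⊆ A := Set.iUnion_subset fun k y ⟨τ, _, hτ⟩ => ⟨τ, hτ⟩
    have hle : P A ≤ P M := le_of_tendsto' hlim fun k =>
      (hσ k).trans (measure_mono (Set.subset_iUnion (fun k => {y | ∃ τ ≤ σ k, ∀ n, y ∈ R n τ}) k))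
    have hsum := measure_inter_add_sdiff (μ := P) A hMm
    rw [Set.inter_eq_right.mpr hMA] at hsum
    refine le_antisymm ?_ (zero_le)
    refine ENNReal.le_of_add_le_add_left (measure_ne_top P M) ?_
    rw [add_zero]
    exact hsum.le.trans hle

/-- Measurable selection of almost optimal points for `⨅ z, H (y, z)`. The function `S` does not
depend on a measure; for every finite measure and every tolerance, some value of its additional
parameter makes it almost optimal almost everywhere. In particular the infimum is a.e. measurable
with respect to every finite measure. -/
theorem exists_selector_iInf {H : Y × (ℕ → ℕ) → EReal} (hH : Measurable H) :
    ∃ S : Y × (ℕ × (ℕ → ℕ → ℕ)) → ℕ → ℕ, Measurable S ∧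
      ∀ (P : Measure Y) [IsFiniteMeasure P], AEMeasurable (fun y => ⨅ z, H (y, z)) P ∧
        ∀ m, ∃ θ, ∀ᵐ y ∂P, H (y, S (y, θ)) ≤ nearLevel m (⨅ z, H (y, z)) := by
  -- an enumeration of the rational levels in which each one occurs infinitely often
  obtain ⟨e, he⟩ := exists_surjective_nat ℚ
  let r : ℕ → ℚ := fun i => e i.unpair.1
  choose D S hD hS hDS hP using fun q : ℚ =>
    exists_selector_of_measurableSet (B := {p : Y × (ℕ → ℕ) | H p < ((q : ℝ) : EReal)})
      (measurableSet_lt hH measurable_const)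
  let E : ℕ → Set (Y × (ℕ → ℕ → ℕ)) := fun i => {p | (p.1, p.2 i) ∈ D (r i)}
  have hpair : ∀ i, Measurable fun p : Y × (ℕ → ℕ → ℕ) => (p.1, p.2 i) := fun i => by fun_prop
  have hE : ∀ i, MeasurableSet (E i) := fun i => hpair i (hD (r i))
  classical
  -- the infimum, computed from the parameter: never too small, and correct for good parameters
  let V : Y × (ℕ → ℕ → ℕ) → EReal := fun p =>
    ⨅ i, if p ∈ E i then (((r i : ℚ) : ℝ) : EReal) else ⊤
  have hV : Measurable V :=
    .iInf fun i => Measurable.ite (hE i) measurable_const measurable_const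
  have hgood : ∀ (P : Measure Y) [IsFiniteMeasure P], ∃ σ, ∀ᵐ y ∂P, V (y, σ) = ⨅ z, H (y, z) := by
    intro P _
    choose σ hσ using fun q => hP q P
    refine ⟨fun i => σ (r i) i.unpair.2, ?_⟩
    have hae : ∀ᵐ y ∂P, ∀ q : ℚ, y ∉ {y | ∃ z, (y, z) ∈ {p : Y × (ℕ → ℕ) | H p < ((q : ℝ) : EReal)}}
        \ ⋃ k, {y | (y, σ q k) ∈ D q} :=
      ae_all_iff.mpr fun q => measure_eq_zero_iff_ae_notMem.mp (hσ q)
    filter_upwards [hae] with y hy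
    refine le_antisymm ?_ (le_iInf fun i => ?_)
    · refine le_of_forall_gt fun a ha => ?_
      obtain ⟨q, hq1, hq2⟩ := EReal.lt_iff_exists_rat_btwn.mp ha
      obtain ⟨z, hz⟩ := iInf_lt_iff.mp hq1
      obtain ⟨k, hk⟩ : ∃ k, (y, σ q k) ∈ D q := by
        by_contra hcon
        exact hy q ⟨⟨z, hz⟩, by simpa using hcon⟩
      obtain ⟨j, rfl⟩ := he q
      refine lt_of_le_of_lt ?_ hq2
      refine (iInf_le _ (Nat.pair j k)).trans (le_of_eq ?_)
      have : (y, fun i => σ (r i) i.unpair.2) ∈ E (Nat.pair j k) := by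
        simpa [E, r] using hk
      rw [if_pos this]
      simp [r]
    · split_ifs with h
      · exact (iInf_le _ _).trans (hDS (r i) _ h).le
      · exact le_top
  -- the first index whose selection is good enough
  let Good : ℕ → Y × (ℕ × (ℕ → ℕ → ℕ)) → Prop := fun i p =>
    (p.1, p.2.2) ∈ E i ∧ (((r i : ℚ) : ℝ) : EReal) < nearLevel p.2.1 (V (p.1, p.2.2))
  have hGood : ∀ i, MeasurableSet {p | Good i p} := by
    intro i
    have h2 : Measurable fun p : Y × (ℕ × (ℕ → ℕ → ℕ)) => (p.1, p.2.2) := by fun_prop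
    have h3 : Measurable fun z : ℕ × EReal => nearLevel z.1 z.2 :=
      measurable_from_prod_countable_right measurable_nearLevel
    have h4 : Measurable fun p : Y × (ℕ × (ℕ → ℕ → ℕ)) => nearLevel p.2.1 (V (p.1, p.2.2)) :=
      h3.comp ((by fun_prop : Measurable fun p : Y × (ℕ × (ℕ → ℕ → ℕ)) => p.2.1).prodMk
        (hV.comp h2))
    exact (h2 (hE i)).inter
      (measurableSet_lt (f := fun _ => (((r i : ℚ) : ℝ) : EReal)) measurable_const h4)
  let cand : ℕ → Y × (ℕ × (ℕ → ℕ → ℕ)) → ℕ → ℕ := fun i p =>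
    match i with
    | 0 => 0
    | i + 1 => S (r i) (p.1, p.2.2 i)
  let test : ℕ → Y × (ℕ × (ℕ → ℕ → ℕ)) → Prop := fun i p =>
    match i with
    | 0 => ¬ ∃ j, Good j p
    | i + 1 => Good i p
  have htest : ∀ p, ∃ i, test i p := fun p => by
    by_cases h : ∃ j, Good j p
    · exact h.imp' Nat.succ fun j hj => hj
    · exact ⟨0, h⟩
  refine ⟨fun p => cand (Nat.find (htest p)) p, ?_, fun P _ => ⟨?_, fun m => ?_⟩⟩
  · refine Measurable.find (f := cand) (p := test) (fun i => ?_) (fun i => ?_) htest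
    · cases i with
      | zero => exact measurable_const
      | succ i => exact (hS (r i)).comp (by fun_prop)
    · cases i with
      | zero =>
        have : {p | test 0 p} = (⋃ j, {p | Good j p})ᶜ := by ext p; simp [test]
        rw [this]
        exact (MeasurableSet.iUnion hGood).compl
      | succ i => exact hGood i
  · obtain ⟨σ, hσ⟩ := hgood P
    exact ⟨fun y => V (y, σ), hV.comp measurable_prodMk_right, hσ.mono fun y hy => hy.symm⟩
  · obtain ⟨σ, hσ⟩ := hgood P
    refine ⟨(m, σ), hσ.mono fun y hy => ?_⟩
    by_cases htop : ⨅ z, H (y, z) = ⊤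
    · rw [htop, nearLevel_top]; exact le_top
    have hex : ∃ j, Good j (y, m, σ) := by
      have := lt_nearLevel m htop
      rw [← hy] at this
      obtain ⟨j, hj⟩ := iInf_lt_iff.mp this
      by_cases hjE : (y, σ) ∈ E j
      · rw [if_pos hjE] at hj
        exact ⟨j, hjE, hj⟩
      · rw [if_neg hjE] at hj
        exact absurd hj not_top_lt
    have hspec := Nat.find_spec (htest (y, m, σ))
    change H (y, cand (Nat.find (htest (y, m, σ))) (y, m, σ)) ≤ _
    generalize Nat.find (htest (y, m, σ)) = i at hspec ⊢
    cases i with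
    | zero => exact absurd hex hspec
    | succ i =>
      have hlt : H (y, S (r i) (y, σ i)) < (((r i : ℚ) : ℝ) : EReal) := hDS (r i) _ hspec.1
      rw [← hy]
      exact (hlt.trans hspec.2).le

end Selection

/-! ### Dynamic programming on noise paths -/

/-- A controlled dynamical system with a single agent: `F t` is the space of the noise that occurs
between the times `t` and `t + 1`. Only the final cost at the horizon `T` matters. -/
structure ControlModel (T : ℕ) (X U F : ℕ → Type*) [∀ t, MeasurableSpace (X t)]
    [∀ t, MeasurableSpace (U t)] [∀ t, MeasurableSpace (F t)] where
  dyn : ∀ t, X t → U t → F t → X (t + 1)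
  measurable_dyn : ∀ t, Measurable fun z : X t × U t × F t => dyn t z.1 z.2.1 z.2.2
  cost : ∀ t, X t → U t → F t → EReal
  measurable_cost : ∀ t, Measurable fun z : X t × U t × F t => cost t z.1 z.2.1 z.2.2
  cost_ne_bot : ∀ t x u w, cost t x u w ≠ ⊥
  finalCost : ∀ t, X t → EReal
  measurable_finalCost : ∀ t, Measurable (finalCost t)
  finalCost_ne_bot : ∀ t x, finalCost t x ≠ ⊥

/-- The noise path which follows `w` before time `k` and `w'` from time `k` on. -/
def splice {F : ℕ → Type*} (k : ℕ) (w w' : ∀ i, F i) : ∀ i, F i :=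
  fun i => if i < k then w i else w' i

section Splice

variable {F : ℕ → Type*}

theorem splice_of_lt {k i : ℕ} (h : i < k) (w w' : ∀ i, F i) : splice k w w' i = w i := if_pos h

theorem splice_of_le {k i : ℕ} (h : k ≤ i) (w w' : ∀ i, F i) : splice k w w' i = w' i :=
  if_neg h.not_gt

theorem measurable_splice [∀ t, MeasurableSpace (F t)] (k : ℕ) :
    Measurable fun p : (∀ i, F i) × (∀ i, F i) => splice k p.1 p.2 := by
  refine measurable_pi_lambda _ fun i => ?_
  unfold splice
  split_ifs <;> fun_prop

/-- Under the law `Q` of a noise path, past and future are independent at all times: restarting the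
path at time `k` with an independent copy does not change its law. -/
def IsSpliceInvariant [∀ t, MeasurableSpace (F t)] (Q : Measure (∀ i, F i)) : Prop :=
  ∀ k, (Q.prod Q).map (fun p => splice k p.1 p.2) = Q

/-- Conditioning on the noises before time `k`. -/
theorem IsSpliceInvariant.expect_eq [∀ t, MeasurableSpace (F t)] {Q : Measure (∀ i, F i)}
    [IsProbabilityMeasure Q] (hQ : IsSpliceInvariant Q) (k : ℕ) {f : (∀ i, F i) → EReal}
    (hf : Measurable f) (h : HasExpectation Q f) :
    expect Q f = expect Q fun w => expect Q fun w' => f (splice k w w') := by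
  have hm := measurable_splice (F := F) k
  have key : expect ((Q.prod Q).map fun p => splice k p.1 p.2) f
      = expect Q fun w => expect Q fun w' => f (splice k w w') := by
    rw [expect_map hm hf.aemeasurable]
    rw [← hQ k] at h
    exact expect_prod (hf.comp hm) ((hasExpectation_map_iff hm hf).mp h).2
  rw [hQ k] at key
  exact key

end Splice

theorem exists_measurable_surjective (Z : Type*) [MeasurableSpace Z] [StandardBorelSpace Z]
    [Nonempty Z] : ∃ r : (ℕ → ℕ) → Z, Measurable r ∧ Function.Surjective r := by
  let := upgradeStandardBorel Z
  obtain ⟨r, hc, hr⟩ := PolishSpace.exists_nat_nat_continuous_surjective Z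
  exact ⟨r, hc.measurable, hr⟩

namespace ControlModel

variable {T : ℕ} {X U F : ℕ → Type*} [∀ t, MeasurableSpace (X t)]
    [∀ t, MeasurableSpace (U t)] [∀ t, MeasurableSpace (F t)] (M : ControlModel T X U F)

/-- The cost from time `t` on of a sequence `v` of controls along the noise path `w`. It is meant for
`t ≤ T`. -/
noncomputable def pathCost (t : ℕ) (x : X t) (v : ∀ s, U s) (w : ∀ i, F i) : EReal :=
  if t < T then M.cost t x (v t) (w t) + pathCost (t + 1) (M.dyn t x (v t) (w t)) v w
  else M.finalCost t x
termination_by T - t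

theorem pathCost_of_lt {t : ℕ} (h : t < T) (x : X t) (v : ∀ s, U s) (w : ∀ i, F i) :
    M.pathCost t x v w
      = M.cost t x (v t) (w t) + M.pathCost (t + 1) (M.dyn t x (v t) (w t)) v w := by
  rw [pathCost, if_pos h]

theorem pathCost_horizon (x : X T) (v : ∀ s, U s) (w : ∀ i, F i) :
    M.pathCost T x v w = M.finalCost T x := by
  rw [pathCost, if_neg (lt_irrefl T)]

theorem pathCost_ne_bot {t : ℕ} (ht : t ≤ T) :
    ∀ (x : X t) (v : ∀ s, U s) (w : ∀ i, F i), M.pathCost t x v w ≠ ⊥ := by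
  induction ht using Nat.decreasingInduction with
  | self => exact fun x v w => by rw [pathCost_horizon]; exact M.finalCost_ne_bot T x
  | of_succ t ht ih =>
    intro x v w
    rw [M.pathCost_of_lt ht]
    exact EReal.add_ne_bot_iff.mpr ⟨M.cost_ne_bot t _ _ _, ih _ _ _⟩

theorem measurable_pathCost {t : ℕ} (ht : t ≤ T) :
    Measurable fun z : X t × (∀ s, U s) × (∀ i, F i) => M.pathCost t z.1 z.2.1 z.2.2 := by
  induction ht using Nat.decreasingInduction with
  | self =>
    simp only [pathCost_horizon]
    exact (M.measurable_finalCost T).comp measurable_fst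
  | of_succ t ht ih =>
    simp only [M.pathCost_of_lt ht]
    have h : Measurable fun z : X t × (∀ s, U s) × (∀ i, F i) => (z.1, z.2.1 t, z.2.2 t) := by
      fun_prop
    refine ((M.measurable_cost t).comp h).add (ih.comp (?_ : Measurable
      fun z : X t × (∀ s, U s) × (∀ i, F i) => (M.dyn t z.1 (z.2.1 t) (z.2.2 t), z.2)))
    exact ((M.measurable_dyn t).comp h).prodMk measurable_snd

theorem pathCost_congr {t : ℕ} (ht : t ≤ T) :
    ∀ (x : X t) {v v' : ∀ s, U s} {w w' : ∀ i, F i}, (∀ s, t ≤ s → v s = v' s) →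
      (∀ s, t ≤ s → w s = w' s) → M.pathCost t x v w = M.pathCost t x v' w' := by
  induction ht using Nat.decreasingInduction with
  | self => exact fun x v v' w w' _ _ => by rw [pathCost_horizon, pathCost_horizon]
  | of_succ t ht ih =>
    intro x v v' w w' hv hw
    rw [M.pathCost_of_lt ht, M.pathCost_of_lt ht, hv t le_rfl, hw t le_rfl]
    congr 1
    exact ih _ (fun s hs => hv s (by lia)) (fun s hs => hw s (by lia))

/-- Admissible controls from time `t` on, as functions of the noise path: the control at time `s`
only depends on the noises before time `s`. -/
structure IsPolicy (t : ℕ) (φ : ∀ s, (∀ i, F i) → U s) : Prop where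
  measurable : ∀ s, Measurable (φ s)
  adapted : ∀ s, t ≤ s → ∀ w w', (∀ i < s, w i = w' i) → φ s w = φ s w'

theorem IsPolicy.mono {t t' : ℕ} {φ : ∀ s, (∀ i, F i) → U s} (h : IsPolicy t φ) (ht : t ≤ t') :
    IsPolicy t' φ :=
  ⟨h.measurable, fun s hs => h.adapted s (ht.trans hs)⟩

/-- A policy remains one when the noises before time `k` are frozen. -/
theorem IsPolicy.freeze {t : ℕ} {φ : ∀ s, (∀ i, F i) → U s} (h : IsPolicy t φ) (k : ℕ)
    (w : ∀ i, F i) : IsPolicy t fun s w' => φ s (splice k w w') := by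
  refine ⟨fun s => (h.measurable s).comp ((measurable_splice k).comp measurable_prodMk_left),
    fun s hs w₁ w₂ hw => h.adapted s hs _ _ fun i hi => ?_⟩
  by_cases hik : i < k
  · rw [splice_of_lt hik, splice_of_lt hik]
  · rw [splice_of_le (not_lt.mp hik), splice_of_le (not_lt.mp hik), hw i hi]

theorem IsPolicy.measurable_pathCost {t : ℕ} (ht : t ≤ T) {φ : ∀ s, (∀ i, F i) → U s}
    (h : IsPolicy t φ) (x : X t) : Measurable fun w => M.pathCost t x (fun s => φ s w) w :=
  (M.measurable_pathCost ht).comp (measurable_const.prodMk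
    ((measurable_pi_lambda _ h.measurable).prodMk measurable_id))

/-- The value function: infimum of the expected costs over all policies. -/
noncomputable def value (Q : Measure (∀ i, F i)) (t : ℕ) (x : X t) : EReal :=
  ⨅ (φ : ∀ s, (∀ i, F i) → U s) (_ : IsPolicy t φ),
    expect Q fun w => M.pathCost t x (fun s => φ s w) w

/-- The random cost that appears in the Bellman equation: cost of the control `u` at time `t`, plus
the value of the next state. -/
noncomputable def bellmanCost (Q : Measure (∀ i, F i)) (t : ℕ) (x : X t) (u : U t) (f : F t) :
    EReal :=
  upperAdd (M.cost t x u f) (M.value Q (t + 1) (M.dyn t x u f))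

/-- All the expected values that define the value functions are well defined. -/
def HasExpectations (Q : Measure (∀ i, F i)) : Prop :=
  ∀ t ≤ T, ∀ (x : X t) (φ : ∀ s, (∀ i, F i) → U s), IsPolicy t φ →
    HasExpectation Q fun w => M.pathCost t x (fun s => φ s w) w

variable {M} {Q : Measure (∀ i, F i)} [IsProbabilityMeasure Q]

theorem value_horizon [∀ t, Nonempty (U t)] (x : X T) : M.value Q T x = M.finalCost T x := by
  have hφ : IsPolicy T fun s (_ : ∀ i, F i) => Classical.arbitrary (U s) :=
    ⟨fun _ => measurable_const, fun _ _ _ _ _ => rfl⟩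
  unfold value
  simp only [pathCost_horizon, expect_const]
  exact le_antisymm (iInf₂_le _ hφ) (le_iInf₂ fun _ _ => le_rfl)

/-- Lower bound for a policy whose control at time `t` is constant: once the noises up to the time
`t + 1` are frozen, the policy is admissible from the next state on. -/
theorem expect_bellmanCost_le_of_const (hQ : IsSpliceInvariant Q) (hE : M.HasExpectations Q)
    {t : ℕ} (ht : t < T) (x : X t) {φ : ∀ s, (∀ i, F i) → U s} (hφ : IsPolicy t φ) {u : U t}
    (hu : ∀ w, φ t w = u) :
    expect Q (fun w => M.bellmanCost Q t x u (w t))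
      ≤ expect Q fun w => M.pathCost t x (fun s => φ s w) w := by
  rw [hQ.expect_eq (t + 1) (hφ.measurable_pathCost M ht.le x) (hE t ht.le x φ hφ)]
  refine expect_mono (Eventually.of_forall fun w => ?_)
  have hψ : IsPolicy (t + 1) fun s w' => φ s (splice (t + 1) w w') :=
    (hφ.freeze (t + 1) w).mono (Nat.le_succ t)
  have hcost : ∀ w', M.pathCost t x (fun s => φ s (splice (t + 1) w w')) (splice (t + 1) w w')
      = M.cost t x u (w t) + M.pathCost (t + 1) (M.dyn t x u (w t))
        (fun s => φ s (splice (t + 1) w w')) w' := by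
    intro w'
    rw [M.pathCost_of_lt ht, hu, splice_of_lt (Nat.lt_succ_self t)]
    congr 1
    exact M.pathCost_congr ht _ (fun _ _ => rfl) fun s hs => splice_of_le hs _ _
  simp only [hcost]
  rw [expect_const_add (M.cost_ne_bot _ _ _ _) (hψ.measurable_pathCost M ht _)
    fun _ => M.pathCost_ne_bot ht _ _ _]
  exact upperAdd_mono_right _ (iInf₂_le _ hψ)

/-- The noises before time `t` are of no use to a policy that starts at time `t`: they can be frozen,
which makes the control at time `t` constant. -/
theorem iInf_expect_bellmanCost_le (hQ : IsSpliceInvariant Q) (hE : M.HasExpectations Q)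
    {t : ℕ} (ht : t < T) (x : X t) :
    ⨅ u, expect Q (fun w => M.bellmanCost Q t x u (w t)) ≤ M.value Q t x := by
  refine le_iInf₂ fun φ hφ => ?_
  rw [hQ.expect_eq t (hφ.measurable_pathCost M ht.le x) (hE t ht.le x φ hφ)]
  refine (expect_const (μ := Q) _).symm.trans_le (expect_mono (Eventually.of_forall fun w => ?_))
  refine (iInf_le _ (φ t w)).trans ((expect_bellmanCost_le_of_const hQ hE ht x
    (hφ.freeze t w) (u := φ t w) fun w' => ?_).trans (le_of_eq ?_))
  · exact hφ.adapted t le_rfl _ _ fun i hi => splice_of_lt hi _ _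
  · congr 1
    funext w'
    exact M.pathCost_congr ht.le _ (fun _ _ => rfl) fun s hs => (splice_of_le hs _ _).symm

/-- A family of policies from time `t` on, jointly measurable in the initial state and in a parameter
from `ℕ → ℕ`, that is rich enough to compute the value function. The policies ignore the noises
before time `t`. -/
structure IsSufficientFamily (M : ControlModel T X U F) (Q : Measure (∀ i, F i)) (t : ℕ)
    (φ : ∀ s, X t → (ℕ → ℕ) → (∀ i, F i) → U s) : Prop where
  measurable : ∀ s, Measurable fun z : X t × (ℕ → ℕ) × (∀ i, F i) => φ s z.1 z.2.1 z.2.2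
  adapted : ∀ s, t ≤ s → ∀ x z w w', (∀ i, t ≤ i → i < s → w i = w' i) → φ s x z w = φ s x z w'
  value_eq : ∀ x, M.value Q t x = ⨅ z, expect Q fun w => M.pathCost t x (fun s => φ s x z w) w

theorem exists_isSufficientFamily_horizon [∀ t, Nonempty (U t)] :
    ∃ φ, IsSufficientFamily M Q T φ :=
  ⟨fun s _ _ _ => Classical.arbitrary (U s), fun _ => measurable_const, fun _ _ _ _ _ _ _ => rfl,
    fun x => by simp only [value_horizon, pathCost_horizon, expect_const, iInf_const]⟩

/-- One step of the backward induction. The lower bound closes a chain of inequalities that the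
policies built from the selector start, so that the Bellman equation at time `t` and a sufficient
family at time `t` are obtained together. -/
theorem bellman_step [∀ t, Nonempty (U t)] [∀ t, StandardBorelSpace (U t)]
    (hQ : IsSpliceInvariant Q) (hE : M.HasExpectations Q) {t : ℕ} (ht : t < T)
    {φ' : ∀ s, X (t + 1) → (ℕ → ℕ) → (∀ i, F i) → U s} (hφ' : IsSufficientFamily M Q (t + 1) φ') :
    (∃ φ, IsSufficientFamily M Q t φ) ∧ ∀ x,
      (∀ u, AEMeasurable (fun w => M.bellmanCost Q t x u (w t)) Q) ∧
      M.value Q t x = ⨅ u, expect Q fun w => M.bellmanCost Q t x u (w t) := by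
  let J : X (t + 1) × (ℕ → ℕ) → EReal := fun p =>
    expect Q fun w => M.pathCost (t + 1) p.1 (fun s => φ' s p.1 p.2 w) w
  have hcostm : Measurable fun z : (X (t + 1) × (ℕ → ℕ)) × (∀ i, F i) =>
      M.pathCost (t + 1) z.1.1 (fun s => φ' s z.1.1 z.1.2 z.2) z.2 := by
    refine (M.measurable_pathCost ht).comp ((by fun_prop : Measurable
      fun z : (X (t + 1) × (ℕ → ℕ)) × (∀ i, F i) => z.1.1).prodMk
      ((measurable_pi_lambda _ fun s => ?_).prodMk measurable_snd))
    exact (hφ'.measurable s).comp (by fun_prop : Measurable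
      fun z : (X (t + 1) × (ℕ → ℕ)) × (∀ i, F i) => (z.1.1, z.1.2, z.2))
  have hJ : Measurable J := measurable_expect hcostm
  let H : (X t × U t × F t) × (ℕ → ℕ) → EReal := fun p =>
    upperAdd (M.cost t p.1.1 p.1.2.1 p.1.2.2) (J (M.dyn t p.1.1 p.1.2.1 p.1.2.2, p.2))
  have hH : Measurable H :=
    measurable_upperAdd.comp (((M.measurable_cost t).comp measurable_fst).prodMk
      (hJ.comp (((M.measurable_dyn t).comp measurable_fst).prodMk measurable_snd)))
  have hHinf : ∀ b : X t × U t × F t, ⨅ z, H (b, z) = M.bellmanCost Q t b.1 b.2.1 b.2.2 := by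
    intro b
    rw [bellmanCost, hφ'.value_eq, upperAdd_iInf (M.cost_ne_bot _ _ _ _)]
  obtain ⟨S, hS, hsel⟩ := exists_selector_iInf hH
  obtain ⟨r, hr, hrs⟩ := exists_measurable_surjective (U t × (ℕ × (ℕ → ℕ → ℕ)))
  -- play `u` at time `t`, then use the selector to continue from the next state
  let φ : ∀ s, X t → (ℕ → ℕ) → (∀ i, F i) → U s := fun s x z w =>
    Function.update (fun s => φ' s (M.dyn t x (r z).1 (w t)) (S ((x, (r z).1, w t), (r z).2)) w)
      t (r z).1 s
  have hφt : ∀ x z w, φ t x z w = (r z).1 := fun x z w => Function.update_self ..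
  have hφs : ∀ s, s ≠ t → ∀ x z w, φ s x z w
      = φ' s (M.dyn t x (r z).1 (w t)) (S ((x, (r z).1, w t), (r z).2)) w :=
    fun s hs x z w => Function.update_of_ne hs ..
  have hφm : ∀ s, Measurable fun z : X t × (ℕ → ℕ) × (∀ i, F i) => φ s z.1 z.2.1 z.2.2 := by
    intro s
    have hb : Measurable fun z : X t × (ℕ → ℕ) × (∀ i, F i) => (z.1, (r z.2.1).1, z.2.2 t) := by
      fun_prop
    rcases eq_or_ne s t with rfl | hs
    · simp only [hφt]; fun_prop
    · simp only [hφs s hs]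
      refine (hφ'.measurable s).comp (((M.measurable_dyn t).comp hb).prodMk
        ((hS.comp (hb.prodMk ?_)).prodMk (by fun_prop)))
      fun_prop
  have hφa : ∀ s, t ≤ s → ∀ x z w w', (∀ i, t ≤ i → i < s → w i = w' i) →
      φ s x z w = φ s x z w' := by
    intro s hs x z w w' hw
    rcases eq_or_ne s t with rfl | hst
    · rw [hφt, hφt]
    · have hlt : t < s := lt_of_le_of_ne hs (Ne.symm hst)
      rw [hφs s hst, hφs s hst, hw t le_rfl hlt]
      exact hφ'.adapted s hlt _ _ _ _ fun i hi => hw i (by lia)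
  have hpol : ∀ x z, IsPolicy t fun s => φ s x z := fun x z =>
    ⟨fun s => (hφm s).comp (by fun_prop : Measurable fun w : ∀ i, F i => (x, z, w)),
      fun s hs w w' hw => hφa s hs x z w w' fun i _ hi => hw i hi⟩
  have hJt : ∀ x z, expect Q (fun w => M.pathCost t x (fun s => φ s x z w) w)
      = expect Q fun w => H ((x, (r z).1, w t), S ((x, (r z).1, w t), (r z).2)) := by
    intro x z
    rw [hQ.expect_eq (t + 1) ((hpol x z).measurable_pathCost M ht.le x) (hE t ht.le x _ (hpol x z))]
    congr 1
    funext w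
    set y := M.dyn t x (r z).1 (w t) with hy
    set z' := S ((x, (r z).1, w t), (r z).2) with hz'
    have hcost : ∀ w', M.pathCost t x (fun s => φ s x z (splice (t + 1) w w'))
        (splice (t + 1) w w') = M.cost t x (r z).1 (w t)
          + M.pathCost (t + 1) y (fun s => φ' s y z' w') w' := by
      intro w'
      have hwt := splice_of_lt (Nat.lt_succ_self t) w w'
      rw [M.pathCost_of_lt ht, hφt, hwt]
      congr 1
      refine M.pathCost_congr ht _ (fun s hs => ?_) fun s hs => splice_of_le hs _ _
      rw [hφs s (by lia), hwt]
      exact hφ'.adapted s hs _ _ _ _ fun i hi _ => splice_of_le hi _ _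
    simp only [hcost]
    exact expect_const_add (M.cost_ne_bot _ _ _ _)
      (hcostm.comp (by fun_prop : Measurable fun w : ∀ i, F i => ((y, z'), w)))
      fun _ => M.pathCost_ne_bot ht _ _ _
  have hbase : ∀ (x : X t) (u : U t), Measurable fun w : ∀ i, F i => (x, u, w t) := fun x u =>
    measurable_const.prodMk (measurable_const.prodMk (measurable_pi_apply t))
  have hae : ∀ x u, AEMeasurable (fun w => M.bellmanCost Q t x u (w t)) Q := by
    intro x u
    have := (hsel (Q.map fun w => (x, u, w t))).1
    simp only [hHinf] at this
    exact this.comp_measurable (hbase x u)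
  have hle1 : ∀ x, M.value Q t x
      ≤ ⨅ z, expect Q fun w => M.pathCost t x (fun s => φ s x z w) w :=
    fun x => le_iInf fun z => iInf₂_le _ (hpol x z)
  have hle2 : ∀ x, ⨅ z, expect Q (fun w => M.pathCost t x (fun s => φ s x z w) w)
      ≤ ⨅ u, expect Q fun w => M.bellmanCost Q t x u (w t) := by
    intro x
    refine le_iInf fun u => ?_
    choose θ hθ using (hsel (Q.map fun w => (x, u, w t))).2
    choose z hz using fun m => hrs (u, θ m)
    -- the tolerance is relative to the law of `(x, u, w t)`, which determines the parameter `θ m`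
    have hlim : ⨅ m, expect Q (fun w => H ((x, u, w t), S ((x, u, w t), θ m)))
        ≤ expect Q fun w => M.bellmanCost Q t x u (w t) := by
      refine iInf_expect_le (hae x u) fun m => ?_
      filter_upwards [ae_of_ae_map (hbase x u).aemeasurable (hθ m)] with w hw
      rwa [hHinf] at hw
    refine (le_iInf fun m => (iInf_le _ (z m)).trans (le_of_eq ?_)).trans hlim
    rw [hJt, hz]
  have hle3 := fun x => iInf_expect_bellmanCost_le hQ hE ht x
  exact ⟨⟨φ, hφm, hφa, fun x => le_antisymm (hle1 x) ((hle2 x).trans (hle3 x))⟩, fun x =>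
    ⟨hae x, le_antisymm ((hle1 x).trans (hle2 x)) (hle3 x)⟩⟩

theorem exists_isSufficientFamily [∀ t, Nonempty (U t)] [∀ t, StandardBorelSpace (U t)]
    (hQ : IsSpliceInvariant Q) (hE : M.HasExpectations Q) {t : ℕ} (ht : t ≤ T) :
    ∃ φ, IsSufficientFamily M Q t φ := by
  induction ht using Nat.decreasingInduction with
  | self => exact exists_isSufficientFamily_horizon
  | of_succ t ht ih =>
    obtain ⟨φ', hφ'⟩ := ih
    exact (bellman_step hQ hE ht hφ').1

theorem value_eq_iInf [∀ t, Nonempty (U t)] [∀ t, StandardBorelSpace (U t)]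
    (hQ : IsSpliceInvariant Q) (hE : M.HasExpectations Q) {t : ℕ} (ht : t < T) (x : X t) :
    (∀ u, AEMeasurable (fun w => M.bellmanCost Q t x u (w t)) Q) ∧
      M.value Q t x = ⨅ u, expect Q fun w => M.bellmanCost Q t x u (w t) := by
  obtain ⟨φ', hφ'⟩ := exists_isSufficientFamily hQ hE (Nat.succ_le_of_lt ht)
  exact (bellman_step hQ hE ht hφ').2 x

end ControlModel

/-! ### From random processes to noise paths -/

section Noise

variable {Ω : Type*} {F : ℕ → Type*}

/-- The noise path of the outcome `ω`. From the time `T` on, where nothing is known about the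
noises, it is replaced by a constant. -/
noncomputable def noisePath (T : ℕ) (η : ∀ t, Ω → F t) (ω₀ ω : Ω) : ∀ t, F t :=
  fun t => if t < T then η t ω else η t ω₀

theorem noisePath_of_lt {T t : ℕ} (h : t < T) (η : ∀ t, Ω → F t) (ω₀ ω : Ω) :
    noisePath T η ω₀ ω t = η t ω := if_pos h

theorem noisePath_of_not_lt {T t : ℕ} (h : ¬t < T) (η : ∀ t, Ω → F t) (ω₀ ω : Ω) :
    noisePath T η ω₀ ω t = η t ω₀ := if_neg h

variable [MeasurableSpace Ω] [∀ t, MeasurableSpace (F t)]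

theorem measurable_noisePath {T : ℕ} {η : ∀ t, Ω → F t} (hη : ∀ t, Measurable (η t)) (ω₀ : Ω) :
    Measurable (noisePath T η ω₀) := by
  refine measurable_pi_lambda _ fun t => ?_
  by_cases h : t < T
  · simpa only [noisePath_of_lt h] using hη t
  · simp only [noisePath_of_not_lt h, measurable_const]

theorem isSpliceInvariant_map_noisePath {T : ℕ} {μ : Measure Ω} [IsProbabilityMeasure μ]
    {η : ∀ t, Ω → F t} (hη : ∀ t, Measurable (η t)) (hind : iIndepFun (fun t : Fin T => η t) μ)
    (ω₀ : Ω) : IsSpliceInvariant (μ.map (noisePath T η ω₀)) := by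
  intro k
  let A : Finset (Fin T) := Finset.univ.filter fun i => (i : ℕ) < k
  let B : Finset (Fin T) := Finset.univ.filter fun i => ¬(i : ℕ) < k
  have hAB : Disjoint A B := Finset.disjoint_filter_filter_not _ _ _
  let a : Ω → ∀ i : A, F i := fun ω i => η i ω
  let b : Ω → ∀ i : B, F i := fun ω i => η i ω
  have ha : Measurable a := measurable_pi_lambda _ fun i => hη i
  have hb : Measurable b := measurable_pi_lambda _ fun i => hη i
  have hprod : μ.map (fun ω => (a ω, b ω)) = (μ.map a).prod (μ.map b) :=
    (indepFun_iff_map_prod_eq_prod_map_map ha.aemeasurable hb.aemeasurable).mp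
      (hind.indepFun_finset A B hAB fun i => hη i)
  -- a path is glued from the noises before time `k` and those from time `k` on
  let glue : (∀ i : A, F i) × (∀ i : B, F i) → ∀ t, F t := fun p t =>
    if h : t < T then
      if hk : t < k then p.1 ⟨⟨t, h⟩, by simpa [A] using hk⟩
      else p.2 ⟨⟨t, h⟩, by simpa [B] using hk⟩
    else η t ω₀
  have hglue : Measurable glue := by
    refine measurable_pi_lambda _ fun t => ?_
    by_cases h : t < T
    · by_cases hk : t < k
      · simp only [glue, h, hk, dite_true]; fun_prop
      · simp only [glue, h, hk, dite_true, dite_false]; fun_prop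
    · simp only [glue, h, dite_false, measurable_const]
  have h1 : ∀ ω ω', glue (a ω, b ω') = splice k (noisePath T η ω₀ ω) (noisePath T η ω₀ ω') := by
    intro ω ω'
    funext t
    by_cases h : t < T <;> by_cases hk : t < k <;> simp [glue, a, b, splice, noisePath, h, hk]
  have h2 : ∀ ω, glue (a ω, b ω) = noisePath T η ω₀ ω := by
    intro ω
    rw [h1]
    funext t
    simp [splice]
  have hpath := measurable_noisePath (T := T) hη ω₀
  rw [Measure.map_prod_map _ _ hpath hpath,
    Measure.map_map (measurable_splice k) (hpath.prodMap hpath)]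
  calc (μ.prod μ).map ((fun p => splice k p.1 p.2) ∘ Prod.map (noisePath T η ω₀) (noisePath T η ω₀))
      = (μ.prod μ).map (glue ∘ Prod.map a b) := by
        congr 1
        funext p
        exact (h1 p.1 p.2).symm
    _ = (μ.map fun ω => (a ω, b ω)).map glue := by
        rw [hprod, Measure.map_prod_map _ _ ha hb, Measure.map_map hglue (ha.prodMap hb)]
    _ = μ.map (noisePath T η ω₀) := by
        rw [Measure.map_map hglue (ha.prodMk hb)]
        congr 1
        funext ω
        exact h2 ω

end Noise

section Transfer

variable {T : ℕ} {N : Type*} {X U E R P : ℕ → N → Type*}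
    [∀ t n, MeasurableSpace (X t n)] [∀ t n, MeasurableSpace (U t n)]
    [∀ t n, MeasurableSpace (E t n)] [∀ t n, MeasurableSpace (R t n)]
    [∀ t n, AddCommGroup (R t n)] [∀ t n, Module ℝ (R t n)]
    [∀ t n, AddCommGroup (P t n)] [∀ t n, Module ℝ (P t n)]
    {Ω : Type*} {F : ℕ → Type*} [∀ t, MeasurableSpace (F t)]

/-- A common description of the two information structures: `η t`, with values in `F t`, is the
noise observed between the times `t` and `t + 1`, and `e t` extracts from it the noise that acts on
the unit `n`. -/
structure IsObservedNoise [MeasurableSpace Ω] (T : ℕ) (μ : Measure Ω) (W : ∀ t n, Ω → E t n)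
    (info : InfoStructure) (n : N) (η : ∀ t, Ω → F t) (e : ∀ t, F t → E (t + 1) n) : Prop where
  measurable : ∀ t, Measurable (η t)
  measurable_extract : ∀ t, Measurable (e t)
  extract_apply : ∀ t ω, e t (η t ω) = W (t + 1) n ω
  iIndepFun : iIndepFun (fun t : Fin T => η t) μ
  field_eq : ∀ t, info.field W t n
    = MeasurableSpace.comap (fun ω (i : Fin t) => η i ω) MeasurableSpace.pi

theorem comap_pi_fin (η : ∀ t, Ω → F t) (t : ℕ) :
    MeasurableSpace.comap (fun ω (i : Fin t) => η i ω) MeasurableSpace.pi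
      = ⨆ i : Fin t, MeasurableSpace.comap (η i) inferInstance := by
  simp only [MeasurableSpace.pi, MeasurableSpace.comap_iSup, MeasurableSpace.comap_comp,
    Function.comp_def]

/-- Shift of the time index from `1, …, t` to `0, …, t - 1`. -/
theorem iSup_Icc_one (m : ℕ → MeasurableSpace Ω) (t : ℕ) :
    ⨆ s ∈ Set.Icc 1 t, m s = ⨆ i : Fin t, m (i + 1) := by
  refine le_antisymm (iSup₂_le fun s hs => ?_) (iSup_le fun i => ?_)
  · obtain ⟨i, rfl⟩ : ∃ i, s = i + 1 := ⟨s - 1, (Nat.sub_add_cancel hs.1).symm⟩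
    exact le_iSup (fun i : Fin t => m (i + 1)) ⟨i, hs.2⟩
  · exact le_iSup₂ (f := fun s (_ : s ∈ Set.Icc 1 t) => m s) (i + 1 : ℕ) ⟨by simp, i.2⟩

theorem iIndepFun_shift [MeasurableSpace Ω] {μ : Measure Ω} {W : ∀ t n, Ω → E t n}
    (h : iIndepFun (fun (t : Set.Icc 1 T) (ω : Ω) (m : N) => W t m ω) μ) :
    iIndepFun (fun (t : Fin T) ω (m : N) => W (t + 1) m ω) μ :=
  h.precomp (g := fun i : Fin T => (⟨i + 1, by simp, i.2⟩ : Set.Icc 1 T))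
    fun i j hij => Fin.ext (Nat.succ_injective (congrArg Subtype.val hij))

theorem isObservedNoise_centralized [MeasurableSpace Ω] {μ : Measure Ω} {W : ∀ t n, Ω → E t n}
    (hW : ∀ t n, Measurable (W t n))
    (h : iIndepFun (fun (t : Set.Icc 1 T) (ω : Ω) (m : N) => W t m ω) μ) (n : N) :
    IsObservedNoise T μ W .centralized n (F := fun t => ∀ m, E (t + 1) m)
      (fun t ω m => W (t + 1) m ω) fun _ f => f n where
  measurable t := measurable_pi_lambda _ fun m => hW _ m
  measurable_extract t := measurable_pi_apply n
  extract_apply _ _ := rfl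
  iIndepFun := iIndepFun_shift h
  field_eq t := by
    rw [comap_pi_fin (F := fun t => ∀ m, E (t + 1) m) fun t ω m => W (t + 1) m ω]
    exact iSup_Icc_one (fun s => MeasurableSpace.comap (fun ω (m : N) => W s m ω) MeasurableSpace.pi) t

theorem isObservedNoise_decentralized [MeasurableSpace Ω] {μ : Measure Ω} {W : ∀ t n, Ω → E t n}
    (hW : ∀ t n, Measurable (W t n))
    (h : iIndepFun (fun (t : Set.Icc 1 T) (ω : Ω) (m : N) => W t m ω) μ) (n : N) :
    IsObservedNoise T μ W .decentralized n (F := fun t => E (t + 1) n)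
      (fun t => W (t + 1) n) fun _ f => f where
  measurable t := hW _ n
  measurable_extract t := measurable_id
  extract_apply _ _ := rfl
  iIndepFun := (iIndepFun_shift h).comp (fun _ f => f n) fun _ => measurable_pi_apply n
  field_eq t := by
    rw [comap_pi_fin (F := fun t => E (t + 1) n) fun t => W (t + 1) n]
    exact iSup_Icc_one (fun s => MeasurableSpace.comap (W s n) inferInstance) t

namespace LocalData

variable (D : LocalData T N X U E R P) (n : N) (p : ∀ t, P t n)

theorem measurable_pricedCost (t : ℕ) : Measurable fun z : X t n × U t n × E (t + 1) n =>
    D.pricedCost n t (p t) z.1 z.2.1 z.2.2 :=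
  (D.measurable_cost t n).add (((D.measurable_pairing t n (p t)).comp
    ((D.measurable_coupling t n).comp
      (measurable_fst.prodMk (measurable_fst.comp measurable_snd)))).coe_real_ereal)

theorem pricedCost_ne_bot (t : ℕ) (x : X t n) (u : U t n) (w : E (t + 1) n) :
    D.pricedCost n t (p t) x u w ≠ ⊥ :=
  EReal.add_ne_bot_iff.mpr ⟨D.cost_ne_bot t n x u w, EReal.coe_ne_bot _⟩

/-- The control problem of the unit `n` under the deterministic prices `p`. The final cost is extended
by `0` to the times other than the horizon. -/
noncomputable def controlModel (e : ∀ t, F t → E (t + 1) n) (he : ∀ t, Measurable (e t)) :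
    ControlModel T (fun t => X t n) (fun t => U t n) F where
  dyn t x u f := D.dyn t n x u (e t f)
  measurable_dyn t := (D.measurable_dyn t n).comp (by have := he t; fun_prop : Measurable
    fun z : X t n × U t n × F t => (z.1, z.2.1, e t z.2.2))
  cost t x u f := D.pricedCost n t (p t) x u (e t f)
  measurable_cost t := (D.measurable_pricedCost n p t).comp (by have := he t; fun_prop : Measurable
    fun z : X t n × U t n × F t => (z.1, z.2.1, e t z.2.2))
  cost_ne_bot t x u f := D.pricedCost_ne_bot n p t x u (e t f)
  finalCost t x := if h : t = T then D.finalCost n (h ▸ x) else 0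
  measurable_finalCost t := by
    by_cases h : t = T
    · subst h; simpa using D.measurable_finalCost n
    · simp [h]
  finalCost_ne_bot t x := by
    split_ifs with h
    · exact D.finalCost_ne_bot n _
    · simp

variable {D n p} {e : ∀ t, F t → E (t + 1) n} {he : ∀ t, Measurable (e t)}

theorem sum_add_finalCost_eq_pathCost {v : ∀ s, U s n} {w : ∀ t, F t} {ξ : ∀ s, X s n} {t : ℕ}
    (ht : t ≤ T) (hξ : ∀ s, t ≤ s → s < T → ξ (s + 1) = D.dyn s n (ξ s) (v s) (e s (w s))) :
    (∑ s ∈ Finset.Ico t T, D.pricedCost n s (p s) (ξ s) (v s) (e s (w s))) + D.finalCost n (ξ T)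
      = (D.controlModel n p e he).pathCost t (ξ t) v w := by
  induction ht using Nat.decreasingInduction with
  | self => simp [ControlModel.pathCost_horizon, controlModel]
  | of_succ t ht ih =>
    rw [Finset.sum_eq_sum_Ico_succ_bot ht, add_assoc, ih fun s hs => hξ s (Nat.le_of_succ_le hs),
      ControlModel.pathCost_of_lt _ ht, hξ t le_rfl ht]
    rfl

variable [MeasurableSpace Ω] {μ : Measure Ω} {W : ∀ t n, Ω → E t n} {info : InfoStructure}
  {η : ∀ t, Ω → F t}

theorem totalCost_eq_pathCost (hη : IsObservedNoise T μ W info n η e) (ω₀ : Ω) {t : ℕ} (ht : t ≤ T)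
    {x : X t n} {x' : ∀ s, Ω → X s n} {u : ∀ s, Ω → U s n} (h : D.IsAdmissible W info n t x x' u)
    {φ : ∀ s, (∀ i, F i) → U s n}
    (hφ : ∀ s, t ≤ s → s < T → ∀ ω, φ s (noisePath T η ω₀ ω) = u s ω) (ω : Ω) :
    D.totalCost W n (fun s _ => p s) t x' u ω
      = (D.controlModel n p e hη.measurable_extract).pathCost t x
        (fun s => φ s (noisePath T η ω₀ ω)) (noisePath T η ω₀ ω) := by
  have hw : ∀ s, s < T → e s (noisePath T η ω₀ ω s) = W (s + 1) n ω := fun s hs => by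
    rw [noisePath_of_lt hs, hη.extract_apply]
  rw [← h.init ω, ← sum_add_finalCost_eq_pathCost (ξ := fun s => x' s ω) ht fun s hs hsT => by
    rw [hφ s hs hsT, hw s hsT]; exact h.dynamics s hs hsT ω]
  unfold totalCost
  congr 1
  refine Finset.sum_congr rfl fun s hs => ?_
  obtain ⟨h1, h2⟩ := Finset.mem_Ico.mp hs
  rw [hφ s h1 h2, hw s h2]

/-- Doob-Dynkin: admissible controls are functions of the noise path. -/
theorem exists_policy_of_isAdmissible [∀ t n, Nonempty (U t n)] [∀ t n, StandardBorelSpace (U t n)]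
    (hη : IsObservedNoise T μ W info n η e) (ω₀ : Ω) {t : ℕ} {x : X t n} {x' : ∀ s, Ω → X s n}
    {u : ∀ s, Ω → U s n} (h : D.IsAdmissible W info n t x x' u) :
    ∃ φ : ∀ s, (∀ i, F i) → U s n, ControlModel.IsPolicy t φ ∧
      ∀ s, t ≤ s → s < T → ∀ ω, φ s (noisePath T η ω₀ ω) = u s ω := by
  have key : ∀ s, ∃ f : (∀ i, F i) → U s n, Measurable f ∧
      (∀ w w', (∀ i < s, w i = w' i) → f w = f w') ∧
      (t ≤ s → s < T → ∀ ω, f (noisePath T η ω₀ ω) = u s ω) := by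
    intro s
    by_cases hs : t ≤ s ∧ s < T
    · have hm := h.nonanticipative s hs.1 hs.2
      rw [hη.field_eq] at hm
      obtain ⟨g, hg, hgu⟩ := hm.exists_eq_measurable_comp
      refine ⟨fun w => g fun i : Fin s => w i, hg.comp (by fun_prop), fun w w' hw => ?_,
        fun _ _ ω => ?_⟩
      · exact congrArg g (funext fun i => hw i i.2)
      · exact (congrArg g (funext fun i : Fin s =>
          noisePath_of_lt (i.2.trans hs.2) η ω₀ ω)).trans (congrFun hgu ω).symm
    · exact ⟨fun _ => Classical.arbitrary _, measurable_const, fun _ _ _ => rfl,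
        fun h1 h2 => absurd ⟨h1, h2⟩ hs⟩
  choose φ h1 h2 h3 using key
  exact ⟨φ, ⟨h1, fun s _ => h2 s⟩, h3⟩

theorem exists_isAdmissible_of_policy [∀ t n, Nonempty (X t n)]
    (hη : IsObservedNoise T μ W info n η e) (ω₀ : Ω) {t : ℕ} (x : X t n)
    {φ : ∀ s, (∀ i, F i) → U s n} (hφ : ControlModel.IsPolicy t φ) :
    ∃ x' : ∀ s, Ω → X s n,
      D.IsAdmissible W info n t x x' fun s ω => φ s (noisePath T η ω₀ ω) := by
  classical
  let start : ∀ s, X s n := fun s => if h : t = s then h ▸ x else Classical.arbitrary _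
  have hstart : start t = x := dif_pos rfl
  let x' : ∀ s, Ω → X s n := fun s => Nat.rec (motive := fun s => Ω → X s n) (fun _ => start 0)
    (fun s ξ ω => if s + 1 = t then start (s + 1) else
      D.dyn s n (ξ ω) (φ s (noisePath T η ω₀ ω)) (W (s + 1) n ω)) s
  refine ⟨x', fun ω => ?_, fun s hs _ ω => ?_, fun s hs hsT => ?_⟩
  · cases t with
    | zero => exact hstart
    | succ t => exact (if_pos rfl).trans hstart
  · exact if_neg (by lia)
  · rw [hη.field_eq]
    -- the noises from time `s` on may be replaced by constants
    let ext : (∀ i : Fin s, F i) → ∀ i, F i := fun a i => if h : i < s then a ⟨i, h⟩ else η i ω₀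
    have hext : Measurable ext := by
      refine measurable_pi_lambda _ fun i => ?_
      by_cases hi : i < s
      · simp only [ext, hi, dite_true]; fun_prop
      · simp only [ext, hi, dite_false, measurable_const]
    have heq : (fun ω => φ s (noisePath T η ω₀ ω))
        = (fun a => φ s (ext a)) ∘ fun ω (i : Fin s) => η i ω := by
      funext ω
      exact hφ.adapted s hs _ _ fun i hi => by
        rw [noisePath_of_lt (hi.trans hsT)]
        simp [ext, hi]
    rw [heq]
    exact ((hφ.measurable s).comp hext).comp (comap_measurable _)

theorem priceValue_eq_value [∀ t n, Nonempty (X t n)] [∀ t n, Nonempty (U t n)]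
    [∀ t n, StandardBorelSpace (U t n)] (hη : IsObservedNoise T μ W info n η e) (ω₀ : Ω) {t : ℕ}
    (ht : t ≤ T) (x : X t n) :
    D.priceValue μ W info n (fun s _ => p s) t x
      = (D.controlModel n p e hη.measurable_extract).value (μ.map (noisePath T η ω₀)) t x := by
  have hpath := measurable_noisePath (T := T) hη.measurable ω₀
  refine le_antisymm (le_iInf₂ fun φ hφ => ?_)
    (le_iInf fun x' => le_iInf fun u => le_iInf fun h => ?_)
  · obtain ⟨x', hx'⟩ := exists_isAdmissible_of_policy (D := D) hη ω₀ x hφ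
    refine (iInf_le_of_le x' (iInf₂_le _ hx')).trans (le_of_eq ?_)
    rw [expect_map hpath (hφ.measurable_pathCost
      (D.controlModel n p e hη.measurable_extract) ht x).aemeasurable]
    congr 1
    funext ω
    exact totalCost_eq_pathCost hη ω₀ ht hx' (fun _ _ _ _ => rfl) ω
  · obtain ⟨φ, hφ, hu⟩ := exists_policy_of_isAdmissible hη ω₀ h
    refine (iInf₂_le φ hφ).trans (le_of_eq ?_)
    rw [expect_map hpath (hφ.measurable_pathCost
      (D.controlModel n p e hη.measurable_extract) ht x).aemeasurable]
    congr 1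
    funext ω
    exact (totalCost_eq_pathCost hη ω₀ ht h hu ω).symm

theorem hasExpectations_controlModel [∀ t n, Nonempty (X t n)]
    (hη : IsObservedNoise T μ W info n η e) (ω₀ : Ω)
    (hE : ∀ t ≤ T, ∀ (x : X t n) (x' : ∀ s, Ω → X s n) (u : ∀ s, Ω → U s n),
      D.IsAdmissible W info n t x x' u →
        HasExpectation μ (D.totalCost W n (fun s _ => p s) t x' u)) :
    (D.controlModel n p e hη.measurable_extract).HasExpectations (μ.map (noisePath T η ω₀)) := by
  intro t ht x φ hφ
  have hpath := measurable_noisePath (T := T) hη.measurable ω₀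
  have hm := hφ.measurable_pathCost (D.controlModel n p e hη.measurable_extract) ht x
  obtain ⟨x', hx'⟩ := exists_isAdmissible_of_policy (D := D) hη ω₀ x hφ
  rw [hasExpectation_map_iff hpath hm,
    ← funext (totalCost_eq_pathCost hη ω₀ ht hx' (fun _ _ _ _ => rfl))]
  exact hE t ht x x' _ hx'

theorem priceValue_bellman [IsProbabilityMeasure μ] [∀ t n, Nonempty (X t n)]
    [∀ t n, Nonempty (U t n)] [∀ t n, StandardBorelSpace (U t n)] (hη : IsObservedNoise T μ W info n η e)
    (hE : ∀ t ≤ T, ∀ (x : X t n) (x' : ∀ s, Ω → X s n) (u : ∀ s, Ω → U s n),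
      D.IsAdmissible W info n t x x' u →
        HasExpectation μ (D.totalCost W n (fun s _ => p s) t x' u)) :
    (∀ x : X T n, D.priceValue μ W info n (fun s _ => p s) T x = D.finalCost n x) ∧
    ∀ t < T, ∀ x : X t n,
      (∀ u : U t n, AEMeasurable (fun ω =>
        upperAdd (D.pricedCost n t (p t) x u (W (t + 1) n ω))
          (D.priceValue μ W info n (fun s _ => p s) (t + 1)
            (D.dyn t n x u (W (t + 1) n ω)))) μ) ∧
      D.priceValue μ W info n (fun s _ => p s) t x =
        ⨅ u : U t n, expect μ (fun ω =>
          upperAdd (D.pricedCost n t (p t) x u (W (t + 1) n ω))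
            (D.priceValue μ W info n (fun s _ => p s) (t + 1)
              (D.dyn t n x u (W (t + 1) n ω)))) := by
  obtain ⟨ω₀⟩ : Nonempty Ω := nonempty_of_isProbabilityMeasure μ
  have hpath := measurable_noisePath (T := T) hη.measurable ω₀
  have : IsProbabilityMeasure (μ.map (noisePath T η ω₀)) :=
    Measure.isProbabilityMeasure_map hpath.aemeasurable
  refine ⟨fun x => ?_, fun t ht x => ?_⟩
  · rw [priceValue_eq_value hη ω₀ le_rfl, ControlModel.value_horizon]
    simp [controlModel]
  obtain ⟨h1, h2⟩ := ControlModel.value_eq_iInf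
    (isSpliceInvariant_map_noisePath hη.measurable hη.iIndepFun ω₀)
    (hasExpectations_controlModel hη ω₀ hE) ht x
  have hcost : ∀ u ω, upperAdd (D.pricedCost n t (p t) x u (W (t + 1) n ω))
      (D.priceValue μ W info n (fun s _ => p s) (t + 1) (D.dyn t n x u (W (t + 1) n ω)))
      = (D.controlModel n p e hη.measurable_extract).bellmanCost (μ.map (noisePath T η ω₀)) t x u
        (noisePath T η ω₀ ω t) := by
    intro u ω
    rw [priceValue_eq_value hη ω₀ ht, noisePath_of_lt ht, ← hη.extract_apply]
    rfl
  simp only [hcost]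
  refine ⟨fun u => (h1 u).comp_measurable hpath, ?_⟩
  rw [priceValue_eq_value hη ω₀ ht.le, h2]
  exact iInf_congr fun u => expect_map hpath (h1 u)

end LocalData
end Transfer

end MultistageDecomposition

open MultistageDecomposition in
theorem proposition3 {T : ℕ} {N : Type*} [Finite N] {X U E R P : ℕ → N → Type*}
    [∀ t n, MeasurableSpace (X t n)] [∀ t n, MeasurableSpace (U t n)]
    [∀ t n, MeasurableSpace (E t n)] [∀ t n, MeasurableSpace (R t n)]
    [∀ t n, AddCommGroup (R t n)] [∀ t n, Module ℝ (R t n)]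
    [∀ t n, AddCommGroup (P t n)] [∀ t n, Module ℝ (P t n)]
    [∀ t n, Nonempty (X t n)] [∀ t n, Nonempty (U t n)]
    [∀ t n, StandardBorelSpace (U t n)]
    (D : LocalData T N X U E R P)
    {Ω : Type*} [MeasurableSpace Ω] (μ : Measure Ω) [IsProbabilityMeasure μ]
    (W : ∀ t n, Ω → E t n) (hW : ∀ t n, Measurable (W t n))
    -- stagewise independence of the global noise process
    (hindep : iIndepFun (fun (t : Set.Icc 1 T) (ω : Ω) (m : N) => W t m ω) μ)
    (info : InfoStructure) (n : N)
    -- a deterministic price process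
    (p : ∀ t, P t n)
    -- the expected values that define the local price value functions are well defined
    (hE : ∀ t ≤ T, ∀ (x : X t n) (x' : ∀ s, Ω → X s n) (u : ∀ s, Ω → U s n),
      D.IsAdmissible W info n t x x' u →
        HasExpectation μ (D.totalCost W n (fun s _ => p s) t x' u)) :
    (∀ x : X T n, D.priceValue μ W info n (fun s _ => p s) T x = D.finalCost n x) ∧
    ∀ t < T, ∀ x : X t n,
      (∀ u : U t n, AEMeasurable (fun ω =>
        upperAdd (D.pricedCost n t (p t) x u (W (t + 1) n ω))
          (D.priceValue μ W info n (fun s _ => p s) (t + 1)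
            (D.dyn t n x u (W (t + 1) n ω)))) μ) ∧
      D.priceValue μ W info n (fun s _ => p s) t x =
        ⨅ u : U t n, expect μ (fun ω =>
          upperAdd (D.pricedCost n t (p t) x u (W (t + 1) n ω))
            (D.priceValue μ W info n (fun s _ => p s) (t + 1)
              (D.dyn t n x u (W (t + 1) n ω)))) := by
  cases info with
  | centralized => exact LocalData.priceValue_bellman (isObservedNoise_centralized hW hindep n) hE
  | decentralized => exact LocalData.priceValue_bellman (isObservedNoise_decentralized hW hindep n) hE
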